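/- Let $(\Omega,\mathcal F,P)$ be a probability space and $d\in\{0,1,2,\dots\}$. Let $L^0(\mathcal F)$ and $L^0(\mathcal F,\mathbb R^d)$ be the sets of a.s.-equivalence classes of real random variables and of random vectors in $\mathbb R^d$, and let $\|x\|\in L^0(\mathcal F)$ be the pointwise Euclidean norm of $x\in L^0(\mathcal F,\mathbb R^d)$. Order $L^0(\mathcal F)$ by $\le$ a.s.; "$\xi<\eta$ on $\Omega$" means $\xi<\eta$ a.s. Let $\mathcal T_c$ be the topology on $L^0(\mathcal F,\mathbb R^d)$ generated by the random balls $\{y:\|x-y\|<r\text{ on }\Omega\}$, where $x\in L^0(\mathcal F,\mathbb R^d)$, $r\in L^0(\mathcal F)$ and $r>0$ on $\Omega$; subsets carry the subspace topology. A set $G\subseteq L^0(\mathcal F,\mathbb R^d)$ is *$\sigma$-stable* if $\sum_n \tilde I_{A_n}x_n\in G$ for every sequence $(x_n)$ in $G$ and every countable measurable partition $(A_n)$ of $\Omega$. It is *a.s. bounded* if $\bigvee_{x\in G}\|x\|$, taken among classes of extended real random variables, lies in $L^0_+(\mathcal F)$. It is *$L^0$-convex* if $\lambda x+(1-\lambda)y\in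 G$ for all $x,y\in G$ and $\lambda\in L^0(\mathcal F)$ with $0\le\lambda\le1$. A map $f:E\to F$ between subsets is *$\sigma$-stable* if $E$ is $\sigma$-stable and, for all such $(x_n)$ in $E$ and $(A_n)$, $f(\sum_n\tilde I_{A_n}x_n)=\sum_n\tilde I_{A_n}f(x_n)$. For $\sigma$-stable $E,F$, the set $E$ is a *$\mathcal T_c$-$r$-image* of $F$ if there are $\sigma$-stable $\mathcal T_c$-continuous maps $h:F\to E$ and $g:E\to F$ with $h\circ g=\mathrm{id}_E$. If $E\subseteq F$ and $g$ is the inclusion, then $h$ is a *$\mathcal T_c$-retraction* of $F$ onto $E$ and $E$ is a *$\mathcal T_c$-retract* of $F$. Put $B=\{x\in L^0(\mathcal F,\mathbb R^d):\|x\|\le1\}$ and $S=\{x\in L^0(\mathcal F,\mathbb R^d):\|x\|=1\}$. Consider the following assertions about $(\Omega,\mathcal F,P)$ and $d$. * (Borsuk) $S$ is not a $\mathcal T_c$-$r$-image of $B$; in particular, $S$ is not a $\mathcal T_c$-retract of $B$. * (Brouwer for the ball) Every $\sigma$-stable $\mathcal T_c$-continuous map $f:B\to B$ has a fixed point. * (Brouwer)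 For every nonempty, $\sigma$-stable, a.s. bounded, $\mathcal T_c$-closed, $L^0$-convex $G\subseteq L^0(\mathcal F,\mathbb R^d)$, every $\sigma$-stable $\mathcal T_c$-continuous map $f:G\to G$ has a fixed point. **Theorem.** 1. (Borsuk) holds if and only if (Brouwer for the ball) holds. 2. (Borsuk) holds if and only if (Brouwer) holds. 3. If (Brouwer for the ball) fails, then $S$ is a $\mathcal T_c$-retract of $B$. 4. Let $D$ be a $\sigma$-stable set with $S\subseteq D\subseteq B$ (for example $D=B$), and let $f:D\to B$ be a $\sigma$-stable $\mathcal T_c$-continuous map with $\|f(x)-x\|>0$ on $\Omega$ for every $x\in D$. Then for every $x\in D$ the set $\{\lambda\in L^0(\mathcal F):\|x+\lambda(f(x)-x)\|=1\}$ has a smallest element $\lambda(x)$, namely $$\lambda(x)=\frac{\langle x,x-f(x)\rangle-\sqrt{\langle x,x-f(x)\rangle^2+\|x-f(x)\|^2(1-\|x\|^2)}}{\|f(x)-x\|^2},$$ where $\langle\cdot,\cdot\rangle$ is the pointwise Euclidean inner product, and $h(x)=x+\lambda(x)(f(x)-x)$ defines a $\mathcal T_c$-retraction $h$ of $D$ onto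 $S$. -/

import Mathlib

open MeasureTheory

noncomputable section

namespace RandomBrouwer

variable {Ω : Type*} [MeasurableSpace Ω]

/-- `L⁰(F, ℝ)`: equivalence classes of real random variables, with the a.s. order of Mathlib. -/
abbrev L0 (P : Measure Ω) := Ω →ₘ[P] ℝ

/-- `L⁰(F, ℝᵈ)`: equivalence classes of random vectors. -/
abbrev L0E (P : Measure Ω) (d : ℕ) := Ω →ₘ[P] EuclideanSpace ℝ (Fin d)

variable {P : Measure Ω} {d : ℕ}

/-- The `L⁰`-norm `‖x‖ ∈ L⁰(F)`, computed pointwise from the Euclidean norm. -/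
def norm0 (x : L0E P d) : L0 P := x.comp (fun v => ‖v‖) continuous_norm

/-- The module multiplication of `L⁰(F)` on `L⁰(F, ℝᵈ)`. -/
def smul0 (l : L0 P) (x : L0E P d) : L0E P d :=
  AEEqFun.comp₂ (fun (a : ℝ) (v : EuclideanSpace ℝ (Fin d)) => a • v)
    (continuous_fst.smul continuous_snd) l x

/-- `ξ < η` on `Ω`, i.e. almost surely strict inequality. -/
def LtOnΩ (ξ η : L0 P) : Prop := ∀ᵐ ω ∂P, ξ ω < η ω

/-- The random open ball `B(x, r)`. -/
def randomBall (x : L0E P d) (r : L0 P) : Set (L0E P d) := {y | LtOnΩ (norm0 (x - y)) r}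

/-- The topology `T_c`, generated by the random open balls with radii `r ∈ L⁰₊₊(F)`. -/
@[reducible] def Tc (P : Measure Ω) (d : ℕ) : TopologicalSpace (L0E P d) :=
  TopologicalSpace.generateFrom
    {U | ∃ (x : L0E P d) (r : L0 P), LtOnΩ 0 r ∧ U = randomBall x r}

/-- A countable measurable partition of `Ω` (some of the pieces may be empty). -/
structure CountablePartition (Ω : Type*) [MeasurableSpace Ω] where
  set : ℕ → Set Ω
  measurableSet : ∀ n, MeasurableSet (set n)
  disjoint : ∀ i j, i ≠ j → Disjoint (set i) (set j)
  iUnion_eq : ⋃ n, set n = Set.univ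

/-- The function `∑ₙ I_{Aₙ} xₙ`, for chosen representatives of the `xₙ`. -/
def concatFun (A : CountablePartition Ω) (x : ℕ → L0E P d) (ω : Ω) : EuclideanSpace ℝ (Fin d) :=
  ∑' n, (A.set n).indicator (x n) ω

theorem concatFun_of_mem (A : CountablePartition Ω) (x : ℕ → L0E P d) {n : ℕ} {ω : Ω}
    (h : ω ∈ A.set n) : concatFun A x ω = x n ω := by
  unfold concatFun
  rw [tsum_eq_single n, Set.indicator_of_mem h]
  intro m hm
  exact Set.indicator_of_notMem (fun h' => Set.disjoint_left.1 (A.disjoint m n hm) h' h) _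

theorem aestronglyMeasurable_concatFun (A : CountablePartition Ω) (x : ℕ → L0E P d) :
    AEStronglyMeasurable (concatFun A x) P := by
  suffices H : AEStronglyMeasurable (concatFun A x) (P.restrict (⋃ n, A.set n)) by
    rwa [A.iUnion_eq, Measure.restrict_univ] at H
  rw [aestronglyMeasurable_iUnion_iff]
  intro n
  refine ((x n).aestronglyMeasurable.mono_measure Measure.restrict_le_self).congr ?_
  filter_upwards [ae_restrict_mem (A.measurableSet n)] with ω hω
  exact (concatFun_of_mem A x hω).symm

/-- The countable concatenation `∑ₙ Ĩ_{Aₙ} xₙ ∈ L⁰(F, ℝᵈ)`. -/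
def concat (A : CountablePartition Ω) (x : ℕ → L0E P d) : L0E P d :=
  AEEqFun.mk (concatFun A x) (aestronglyMeasurable_concatFun A x)

/-- `σ`-stable subsets of `L⁰(F, ℝᵈ)`. -/
def IsSigmaStable (G : Set (L0E P d)) : Prop :=
  ∀ (A : CountablePartition Ω) (x : ℕ → L0E P d), (∀ n, x n ∈ G) → concat A x ∈ G

/-- `L⁰`-convex subsets of `L⁰(F, ℝᵈ)`. -/
def IsL0Convex (G : Set (L0E P d)) : Prop :=
  ∀ x ∈ G, ∀ y ∈ G, ∀ l : L0 P, 0 ≤ l → l ≤ 1 → smul0 l x + smul0 (1 - l) y ∈ G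

/-- The inclusion of `L⁰(F)` in the classes of extended real-valued random variables. -/
def toExt (ξ : L0 P) : Ω →ₘ[P] EReal := ξ.comp (fun a : ℝ => (a : EReal)) continuous_coe_real_ereal

/-- `G` is a.s. bounded: the supremum of `{‖x‖ : x ∈ G}` among the classes of extended real-valued
random variables is (the image of) an element of `L⁰₊(F)`. -/
def IsASBounded (G : Set (L0E P d)) : Prop :=
  ∃ s : L0 P, 0 ≤ s ∧ IsLUB ((fun x => toExt (norm0 x)) '' G) (toExt s)

/-- `σ`-stable mappings between subsets of `L⁰(F, ℝᵈ)`; the domain is required to be `σ`-stable. -/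
def IsStableMap {E F : Set (L0E P d)} (f : E → F) : Prop :=
  IsSigmaStable E ∧
    ∀ (A : CountablePartition Ω) (x : ℕ → E) (z : E),
      (z : L0E P d) = concat A (fun n => (x n : L0E P d)) →
        (f z : L0E P d) = concat A (fun n => (f (x n) : L0E P d))

/-- Continuity from `(E, T_c)` to `(F, T_c)`, for the subspace topologies. -/
def IsTcContinuous {E F : Set (L0E P d)} (f : E → F) : Prop :=
  @Continuous E F ((Tc P d).induced Subtype.val) ((Tc P d).induced Subtype.val) f

/-- `E` is a `T_c`-`r`-image of `F`. -/
def IsTcRImage (E F : Set (L0E P d)) : Prop :=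
  IsSigmaStable E ∧ IsSigmaStable F ∧
    ∃ (h : F → E) (g : E → F), IsStableMap h ∧ IsTcContinuous h ∧
      IsStableMap g ∧ IsTcContinuous g ∧ ∀ x : E, h (g x) = x

/-- `h` is a `T_c`-retraction of `F` onto its subset `E` (the inclusion of `E` in `F` is itself
`σ`-stable and `T_c`-continuous). -/
def IsTcRetraction {E F : Set (L0E P d)} (hEF : E ⊆ F) (h : F → E) : Prop :=
  IsSigmaStable E ∧ IsSigmaStable F ∧ IsStableMap h ∧ IsTcContinuous h ∧
    ∀ x : E, h (Set.inclusion hEF x) = x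

/-- `E` is a `T_c`-retract of `F`. -/
def IsTcRetract (E F : Set (L0E P d)) : Prop :=
  ∃ (hEF : E ⊆ F) (h : F → E), IsTcRetraction hEF h

/-- `L⁰(F, M)` as a subset of `L⁰(F, ℝᵈ)`, for `M ⊆ ℝᵈ`. -/
def L0Set (P : Measure Ω) {d : ℕ} (M : Set (EuclideanSpace ℝ (Fin d))) : Set (L0E P d) :=
  {x | ∀ᵐ ω ∂P, x ω ∈ M}

/-- The random closed unit ball. -/
def unitBall (P : Measure Ω) (d : ℕ) : Set (L0E P d) :=
  L0Set P (Metric.closedBall (0 : EuclideanSpace ℝ (Fin d)) 1)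

/-- The random unit sphere. -/
def unitSphere (P : Measure Ω) (d : ℕ) : Set (L0E P d) :=
  L0Set P (Metric.sphere (0 : EuclideanSpace ℝ (Fin d)) 1)

/-- The assertion of the random Borsuk theorem over `(Ω, F, P)` in dimension `d`. -/
def RandomBorsuk (P : Measure Ω) (d : ℕ) : Prop :=
  ¬ IsTcRImage (unitSphere P d) (unitBall P d) ∧ ¬ IsTcRetract (unitSphere P d) (unitBall P d)

/-- The assertion of the random Brouwer fixed point theorem for the random closed unit ball. -/
def RandomBrouwerBall (P : Measure Ω) (d : ℕ) : Prop :=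
  ∀ f : unitBall P d → unitBall P d, IsStableMap f → IsTcContinuous f → ∃ x, f x = x

/-- The assertion of the random Brouwer fixed point theorem. -/
def RandomBrouwerTheorem (P : Measure Ω) (d : ℕ) : Prop :=
  ∀ G : Set (L0E P d), G.Nonempty → IsSigmaStable G → IsASBounded G →
    @IsClosed _ (Tc P d) G → IsL0Convex G →
    ∀ f : G → G, IsStableMap f → IsTcContinuous f → ∃ x, f x = x

/-- The set `L = {λ ∈ L⁰(F) : ‖x + λ (y - x)‖ = 1}`. -/
def lineSphereParams (x y : L0E P d) : Set (L0 P) :=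
  {l | norm0 (x + smul0 l (y - x)) = 1}

end RandomBrouwer

end

namespace RandomBrouwer

open Filter Topology

variable {Ω : Type*} [MeasurableSpace Ω] {P : Measure Ω} {d : ℕ}

/-! Neither Borsuk nor Brouwer is proved outright; each is derived from the other. The common tool
is gluing: a stable map may be evaluated at random indices, so any measurable choice of bad points
can be assembled into one bad random point. Hence stable `T_c`-continuous maps respect a.s.
convergence (`IsStableMap.tendsto_ae`), and a measurable Bolzano–Weierstrass theorem replaces
compactness.

Borsuk gives Brouwer for the ball: suppose `f` has no fixed point. This does not yet say that `f`
moves every `x` on almost all of `Ω`, so the ray construction does not apply to `f` itself. Instead,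
`f` is restricted to constants from a dense sequence of the deterministic ball. Almost every slice
is uniformly continuous (`ae_uniform_on_seq`), and if almost all slices had approximate fixed
points, a random limit of them would be fixed by `f` (`exists_eq_of_ae_approx`). So some slice
extends to a continuous self-map of the ball whose displacement is bounded below. Acting pointwise,
that map moves every random vector almost surely, and following rays to the sphere gives a
retraction (`exists_retraction_of_forall_ne`).

Brouwer for the ball gives Borsuk: with `h ∘ g = id`, a fixed point of `g ∘ (-·) ∘ h` produces a
point of the sphere equal to its own antipode.

The general Brouwer statement reduces to the ball by a random rescaling and the nonexpansive
nearest-point projection onto `G` (`exists_isNearest`, `IsNearest.norm_sub_le`). -/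

/-! ### Pointwise descriptions of the `L⁰` operations. -/

theorem coeFn_norm0 (x : L0E P d) : ∀ᵐ ω ∂P, norm0 x ω = ‖x ω‖ :=
  AEEqFun.coeFn_comp _ _ _

theorem coeFn_smul0 (l : L0 P) (x : L0E P d) : ∀ᵐ ω ∂P, smul0 l x ω = l ω • x ω :=
  AEEqFun.coeFn_comp₂ _ _ _ _

theorem ltOnΩ_norm0_sub_iff (x y : L0E P d) (r : L0 P) :
    LtOnΩ (norm0 (x - y)) r ↔ ∀ᵐ ω ∂P, ‖x ω - y ω‖ < r ω := by
  unfold LtOnΩ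
  apply eventually_congr
  filter_upwards [coeFn_norm0 (x - y), AEEqFun.coeFn_sub x y] with ω h1 h2
  rw [h1, h2, Pi.sub_apply]

theorem ltOnΩ_zero_iff (r : L0 P) : LtOnΩ 0 r ↔ ∀ᵐ ω ∂P, 0 < r ω := by
  unfold LtOnΩ
  apply eventually_congr
  filter_upwards [AEEqFun.coeFn_zero (α := Ω) (μ := P) (β := ℝ)] with ω h
  rw [h, Pi.zero_apply]

theorem ltOnΩ_zero_norm0_sub_iff (x y : L0E P d) :
    LtOnΩ 0 (norm0 (x - y)) ↔ ∀ᵐ ω ∂P, x ω ≠ y ω := by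
  rw [ltOnΩ_zero_iff]
  apply eventually_congr
  filter_upwards [coeFn_norm0 (x - y), AEEqFun.coeFn_sub x y] with ω h1 h2
  rw [h1, h2, Pi.sub_apply, norm_pos_iff, sub_ne_zero]

theorem mem_randomBall_iff {x y : L0E P d} {r : L0 P} :
    y ∈ randomBall x r ↔ ∀ᵐ ω ∂P, ‖x ω - y ω‖ < r ω :=
  ltOnΩ_norm0_sub_iff x y r

/-! ### Gluing along measurable partitions -/

theorem coeFn_concat (A : CountablePartition Ω) (x : ℕ → L0E P d) :
    ∀ᵐ ω ∂P, ∀ n, ω ∈ A.set n → concat A x ω = x n ω := by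
  filter_upwards [AEEqFun.coeFn_mk (concatFun A x) (aestronglyMeasurable_concatFun A x)]
    with ω h n hn
  exact h.trans (concatFun_of_mem A x hn)

theorem CountablePartition.exists_mem (A : CountablePartition Ω) (ω : Ω) : ∃ n, ω ∈ A.set n := by
  simpa using A.iUnion_eq.ge (Set.mem_univ ω)

theorem eq_concat_iff {A : CountablePartition Ω} {x : ℕ → L0E P d} {z : L0E P d} :
    z = concat A x ↔ ∀ᵐ ω ∂P, ∀ n, ω ∈ A.set n → z ω = x n ω := by
  constructor
  · rintro rfl
    exact coeFn_concat A x
  · intro h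
    apply AEEqFun.ext
    filter_upwards [h, coeFn_concat A x] with ω h1 h2
    obtain ⟨n, hn⟩ := A.exists_mem ω
    rw [h1 n hn, h2 n hn]

/-- The partition of `Ω` into the fibres of a measurable function with values in `ℕ`. -/
def CountablePartition.ofMeasurable (n : Ω → ℕ) (hn : Measurable n) : CountablePartition Ω where
  set k := n ⁻¹' {k}
  measurableSet k := hn (measurableSet_singleton k)
  disjoint _ _ hij := Set.disjoint_left.2 fun _ hi hj => hij (hi.symm.trans hj)
  iUnion_eq := Set.eq_univ_of_forall fun ω => Set.mem_iUnion.2 ⟨n ω, rfl⟩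

theorem IsSigmaStable.exists_glue {E : Set (L0E P d)} (hE : IsSigmaStable E) (x : ℕ → E)
    {n : Ω → ℕ} (hn : Measurable n) :
    ∃ z : E, ∀ᵐ ω ∂P, (z : L0E P d) ω = (x (n ω) : L0E P d) ω :=
  ⟨⟨_, hE (.ofMeasurable n hn) _ fun k => (x k).2⟩,
    (coeFn_concat _ _).mono fun ω h => h (n ω) rfl⟩

theorem IsStableMap.exists_glue {E F : Set (L0E P d)} {f : E → F} (hf : IsStableMap f)
    (x : ℕ → E) {n : Ω → ℕ} (hn : Measurable n) :
    ∃ z : E, ∀ᵐ ω ∂P, (z : L0E P d) ω = (x (n ω) : L0E P d) ω ∧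
      (f z : L0E P d) ω = (f (x (n ω)) : L0E P d) ω := by
  let A := CountablePartition.ofMeasurable n hn
  let z : E := ⟨_, hf.1 A _ fun k => (x k).2⟩
  refine ⟨z, ?_⟩
  filter_upwards [coeFn_concat A fun k => (x k : L0E P d),
    eq_concat_iff.1 (hf.2 A x z rfl)] with ω h1 h2
  exact ⟨h1 (n ω) rfl, h2 (n ω) rfl⟩

theorem isSigmaStable_L0Set (M : Set (EuclideanSpace ℝ (Fin d))) : IsSigmaStable (L0Set P M) := by
  intro A x hx
  filter_upwards [coeFn_concat A x, ae_all_iff.2 hx] with ω h1 h2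
  obtain ⟨n, hn⟩ := A.exists_mem ω
  rw [h1 n hn]
  exact h2 n

theorem IsStableMap.comp {E F G : Set (L0E P d)} {g : F → G} {f : E → F} (hg : IsStableMap g)
    (hf : IsStableMap f) : IsStableMap (g ∘ f) :=
  ⟨hf.1, fun A x z hz => hg.2 A (fun n => f (x n)) (f z) (hf.2 A x z hz)⟩

/-- A predicate on `ℕ` depending measurably on `ω` has a measurable choice of witnesses. -/
theorem exists_measurable_nat_choice {p : Ω → ℕ → Prop} (hp : ∀ k, MeasurableSet {ω | p ω k}) :
    ∃ n : Ω → ℕ, Measurable n ∧ ∀ ω, (∃ k, p ω k) → p ω (n ω) := by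
  classical
  -- The second alternative makes the least-index search total: where no witness exists, the value
  -- is 0.
  have hex : ∀ ω, ∃ k, p ω k ∨ ¬ ∃ k, p ω k := fun ω => by
    by_cases h : ∃ k, p ω k
    · exact h.imp fun k hk => Or.inl hk
    · exact ⟨0, Or.inr h⟩
  have hm : MeasurableSet {ω | ∃ k, p ω k} := by
    rw [Set.ofPred_exists]
    exact MeasurableSet.iUnion hp
  refine ⟨fun ω => Nat.find (hex ω), measurable_find hex fun k => ?_, fun ω h => ?_⟩
  · exact (hp k).union hm.compl
  · exact (Nat.find_spec (hex ω)).resolve_right (not_not.2 h)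

/-! ### The topology `T_c` -/

theorem randomBall_isOpen (x : L0E P d) {r : L0 P} (hr : ∀ᵐ ω ∂P, 0 < r ω) :
    IsOpen[Tc P d] (randomBall x r) :=
  TopologicalSpace.isOpen_generateFrom_of_mem ⟨x, r, (ltOnΩ_zero_iff r).2 hr, rfl⟩

/-- The triangle inequality holds for each `ω`, so the metric-space argument works with random
radii: balls centred at a point form a neighbourhood base there. -/
theorem isOpen_Tc_iff {U : Set (L0E P d)} :
    IsOpen[Tc P d] U ↔
      ∀ x ∈ U, ∃ r : L0 P, (∀ᵐ ω ∂P, 0 < r ω) ∧ randomBall x r ⊆ U := by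
  constructor
  · intro h
    induction h with
    | basic U hU =>
      obtain ⟨y, r, -, rfl⟩ := hU
      intro x hx
      rw [mem_randomBall_iff] at hx
      have hsub : ∀ᵐ ω ∂P, (r - norm0 (y - x)) ω = r ω - ‖y ω - x ω‖ := by
        filter_upwards [AEEqFun.coeFn_sub r (norm0 (y - x)), coeFn_norm0 (y - x),
          AEEqFun.coeFn_sub y x] with ω h1 h2 h3
        rw [h1, Pi.sub_apply, h2, h3, Pi.sub_apply]
      refine ⟨r - norm0 (y - x), ?_, fun z hz => ?_⟩
      · filter_upwards [hx, hsub] with ω h1 h2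
        rw [h2]
        linarith
      · rw [mem_randomBall_iff] at hz ⊢
        filter_upwards [hz, hsub] with ω h1 h2
        have := norm_sub_le_norm_sub_add_norm_sub (y ω) (x ω) (z ω)
        rw [h2] at h1
        linarith
    | univ =>
      refine fun x _ => ⟨1, ?_, Set.subset_univ _⟩
      filter_upwards [AEEqFun.coeFn_one (α := Ω) (μ := P) (β := ℝ)] with ω h
      rw [h]
      exact one_pos
    | inter U V _ _ hU hV =>
      rintro x ⟨hxU, hxV⟩
      obtain ⟨r, hr, hrU⟩ := hU x hxU
      obtain ⟨s, hs, hsV⟩ := hV x hxV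
      have hinf := AEEqFun.coeFn_inf r s
      refine ⟨r ⊓ s, ?_, fun z hz => ⟨hrU ?_, hsV ?_⟩⟩
      · filter_upwards [hr, hs, hinf] with ω h1 h2 h3
        rw [h3]
        exact lt_min h1 h2
      all_goals
        rw [mem_randomBall_iff] at hz ⊢
        filter_upwards [hz, hinf] with ω h1 h2
        rw [h2] at h1
      exacts [h1.trans_le (min_le_left _ _), h1.trans_le (min_le_right _ _)]
    | sUnion S _ hS =>
      rintro x ⟨U, hU, hx⟩
      obtain ⟨r, hr, hrU⟩ := hS U hU x hx
      exact ⟨r, hr, hrU.trans (Set.subset_sUnion_of_mem hU)⟩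
  · intro h
    let _ := Tc P d
    choose! r hr hrU using h
    have : U = ⋃ x ∈ U, randomBall x (r x) := by
      refine Set.Subset.antisymm (fun x hx => Set.mem_biUnion hx ?_) (Set.iUnion₂_subset hrU)
      rw [mem_randomBall_iff]
      filter_upwards [hr x hx] with ω h
      simpa using h
    rw [this]
    exact isOpen_biUnion fun x hx => randomBall_isOpen x (hr x hx)

theorem mem_nhds_Tc_iff {x : L0E P d} {s : Set (L0E P d)} :
    s ∈ @nhds _ (Tc P d) x ↔ ∃ r : L0 P, (∀ᵐ ω ∂P, 0 < r ω) ∧ randomBall x r ⊆ s := by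
  let _ := Tc P d
  constructor
  · intro h
    obtain ⟨U, hUs, hU, hx⟩ := mem_nhds_iff.1 h
    obtain ⟨r, hr, hrU⟩ := isOpen_Tc_iff.1 hU x hx
    exact ⟨r, hr, hrU.trans hUs⟩
  · rintro ⟨r, hr, hrs⟩
    refine mem_of_superset ((randomBall_isOpen x hr).mem_nhds ?_) hrs
    rw [mem_randomBall_iff]
    filter_upwards [hr] with ω h
    simpa using h

theorem isTcContinuous_iff {E F : Set (L0E P d)} {f : E → F} :
    IsTcContinuous f ↔ ∀ x : E, ∀ ε : L0 P, (∀ᵐ ω ∂P, 0 < ε ω) →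
      ∃ δ : L0 P, (∀ᵐ ω ∂P, 0 < δ ω) ∧ ∀ y : E, (∀ᵐ ω ∂P, ‖x.1 ω - y.1 ω‖ < δ ω) →
        ∀ᵐ ω ∂P, ‖(f x).1 ω - (f y).1 ω‖ < ε ω := by
  let _ := Tc P d
  have h1 : IsTcContinuous f ↔ ∀ x : E, Tendsto f (𝓝 x) (𝓝 (f x)) :=
    continuous_iff_continuousAt
  rw [h1]
  refine forall_congr' fun x => ?_
  rw [nhds_subtype, nhds_subtype, tendsto_comap_iff]
  constructor
  · intro h ε hε
    obtain ⟨s, hs, hsub⟩ := mem_comap.1 (h (mem_nhds_Tc_iff.2 ⟨ε, hε, subset_rfl⟩))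
    obtain ⟨δ, hδ, hδs⟩ := mem_nhds_Tc_iff.1 hs
    exact ⟨δ, hδ, fun y hy =>
      mem_randomBall_iff.1 (hsub (a := y) (hδs (mem_randomBall_iff.2 hy)))⟩
  · intro h s hs
    obtain ⟨ε, hε, hεs⟩ := mem_nhds_Tc_iff.1 hs
    obtain ⟨δ, hδ, H⟩ := h ε hε
    exact mem_comap.2 ⟨_, mem_nhds_Tc_iff.2 ⟨δ, hδ, subset_rfl⟩, fun y hy =>
      hεs (mem_randomBall_iff.2 (H y (mem_randomBall_iff.1 hy)))⟩

theorem IsTcContinuous.comp {E F G : Set (L0E P d)} {g : F → G} {f : E → F}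
    (hg : IsTcContinuous g) (hf : IsTcContinuous f) : IsTcContinuous (g ∘ f) :=
  @Continuous.comp _ _ _ (_) (_) (_) _ _ hg hf

/-- A random Lipschitz map is stable and `T_c`-continuous. -/
theorem stable_continuous_of_lipschitz {E F : Set (L0E P d)} (hE : IsSigmaStable E) {f : E → F}
    (K : L0 P) (hf : ∀ x y : E, ∀ᵐ ω ∂P, ‖(f x).1 ω - (f y).1 ω‖ ≤ K ω * ‖x.1 ω - y.1 ω‖) :
    IsStableMap f ∧ IsTcContinuous f := by
  refine ⟨⟨hE, fun A x z hz => eq_concat_iff.2 ?_⟩, isTcContinuous_iff.2 fun x ε hε => ?_⟩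
  · filter_upwards [eq_concat_iff.1 hz, ae_all_iff.2 fun n => hf z (x n)] with ω h1 h2 n hn
    have := h2 n
    rw [h1 n hn, sub_self, norm_zero, mul_zero] at this
    exact sub_eq_zero.1 (norm_le_zero_iff.1 this)
  · have hm : Measurable fun ω => ε ω / (|K ω| + 1) :=
      ε.measurable.div ((continuous_abs.measurable.comp K.measurable).add_const 1)
    have hδ := AEEqFun.coeFn_mk (μ := P) _ hm.aestronglyMeasurable
    refine ⟨AEEqFun.mk _ hm.aestronglyMeasurable, ?_, fun y hy => ?_⟩
    · filter_upwards [hε, hδ] with ω h1 h2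
      rw [h2]
      positivity
    · filter_upwards [hy, hδ, hf x y] with ω h1 h2 h3
      rw [h2, lt_div_iff₀ (by positivity)] at h1
      nlinarith [norm_nonneg (x.1 ω - y.1 ω), le_abs_self (K ω)]

/-- A map given pointwise by a continuous function of `x` and `f x` is stable and
`T_c`-continuous if `f` is. -/
theorem stable_continuous_of_pointwise {E F G : Set (L0E P d)} {f : E → F} (hf : IsStableMap f)
    (hfc : IsTcContinuous f)
    {U : Set (EuclideanSpace ℝ (Fin d) × EuclideanSpace ℝ (Fin d))} (hU : IsOpen U)
    {H : EuclideanSpace ℝ (Fin d) × EuclideanSpace ℝ (Fin d) → EuclideanSpace ℝ (Fin d)}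
    (hH : ContinuousOn H U) {h : E → G}
    (hh : ∀ x : E, ∀ᵐ ω ∂P, (x.1 ω, (f x).1 ω) ∈ U ∧ (h x).1 ω = H (x.1 ω, (f x).1 ω)) :
    IsStableMap h ∧ IsTcContinuous h := by
  refine ⟨⟨hf.1, fun A x z hz => eq_concat_iff.2 ?_⟩, isTcContinuous_iff.2 fun x ε hε => ?_⟩
  · filter_upwards [eq_concat_iff.1 hz, eq_concat_iff.1 (hf.2 A x z hz), hh z,
      ae_all_iff.2 fun n => hh (x n)] with ω h1 h2 h3 h4 n hn
    rw [h3.2, (h4 n).2, h1 n hn, h2 n hn]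
  · let q := TopologicalSpace.denseSeq (EuclideanSpace ℝ (Fin d) × EuclideanSpace ℝ (Fin d))
    -- A modulus of continuity of `H` at `(x ω, f x ω)`, tested only on a countable dense set so
    -- that the event is measurable. The bound `ε / 2` leaves room for the strict inequality after
    -- passing to limits.
    let p : Ω → ℕ → Prop := fun ω n => ∀ k, q k ∈ U →
      dist (q k) (x.1 ω, (f x).1 ω) < 1 / ((n : ℝ) + 1) → ‖(h x).1 ω - H (q k)‖ ≤ ε ω / 2
    have hp : ∀ n, MeasurableSet {ω | p ω n} := fun n => by
      simp only [p, Set.ofPred_forall]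
      refine MeasurableSet.iInter fun k => MeasurableSet.iInter fun _ => ?_
      refine MeasurableSet.imp (measurableSet_lt ?_ measurable_const)
        (measurableSet_le ?_ (ε.measurable.div_const 2))
      · exact measurable_const.dist (x.1.measurable.prodMk (f x).1.measurable)
      · exact ((h x).1.measurable.sub_const _).norm
    obtain ⟨n, hn, hpn⟩ := exists_measurable_nat_choice hp
    have hm : Measurable fun ω => 1 / ((n ω : ℝ) + 1) :=
      measurable_const.div ((measurable_from_top.comp hn).add_const 1)
    have hη := AEEqFun.coeFn_mk (μ := P) _ hm.aestronglyMeasurable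
    set η : L0 P := AEEqFun.mk _ hm.aestronglyMeasurable
    have hηpos : ∀ᵐ ω ∂P, 0 < η ω := by
      filter_upwards [hη] with ω h
      rw [h]
      positivity
    obtain ⟨δ, hδ, hδf⟩ := isTcContinuous_iff.1 hfc x η hηpos
    have hinf := AEEqFun.coeFn_inf δ η
    refine ⟨δ ⊓ η, ?_, fun y hy => ?_⟩
    · filter_upwards [hδ, hηpos, hinf] with ω h1 h2 h3
      rw [h3]
      exact lt_min h1 h2
    have hyδ : ∀ᵐ ω ∂P, ‖x.1 ω - y.1 ω‖ < δ ω ∧ ‖x.1 ω - y.1 ω‖ < η ω := by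
      filter_upwards [hy, hinf] with ω h1 h2
      rw [h2] at h1
      exact lt_min_iff.1 h1
    filter_upwards [hyδ, hδf y (hyδ.mono fun _ h => h.1), hη, hε, hh x, hh y]
      with ω h1 h2 h3 h4 h5 h6
    rw [h3] at h1 h2
    have hex : ∃ k, p ω k := by
      have hc := (hH.continuousAt (hU.mem_nhds h5.1))
      obtain ⟨t, ht, hball⟩ := Metric.continuousAt_iff.1 hc (ε ω / 2) (half_pos h4)
      obtain ⟨m, hm⟩ := exists_nat_one_div_lt ht
      refine ⟨m, fun k _ hk => ?_⟩
      have := (hball (hk.trans hm)).le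
      rwa [← h5.2, dist_comm, dist_eq_norm] at this
    have hpω := hpn ω hex
    have hyball : dist (y.1 ω, (f y).1 ω) (x.1 ω, (f x).1 ω) < 1 / ((n ω : ℝ) + 1) := by
      rw [Prod.dist_eq, dist_comm, dist_comm ((f y).1 ω), dist_eq_norm, dist_eq_norm]
      exact max_lt h1.2 h2
    rw [h6.2]
    refine lt_of_le_of_lt ?_ (half_lt_self h4)
    have hc : ContinuousAt (fun v => ‖(h x).1 ω - H v‖) (y.1 ω, (f y).1 ω) :=
      (continuousAt_const.sub (hH.continuousAt (hU.mem_nhds h6.1))).norm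
    -- A failure at `(y ω, f y ω)` would persist on a neighbourhood, which contains a point of the
    -- dense sequence.
    by_contra hlt
    obtain ⟨k, hk⟩ := (TopologicalSpace.denseRange_denseSeq _).exists_mem_open
      (isOpen_interior (s := U ∩ (Metric.ball (x.1 ω, (f x).1 ω) (1 / ((n ω : ℝ) + 1)) ∩
        {v | ε ω / 2 < ‖(h x).1 ω - H v‖})))
      ⟨_, mem_interior_iff_mem_nhds.2 (inter_mem (hU.mem_nhds h6.1)
        (inter_mem (Metric.isOpen_ball.mem_nhds hyball)
          (hc.eventually (lt_mem_nhds (not_le.1 hlt)))))⟩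
    have hk' := interior_subset hk
    exact absurd (hpω k hk'.1 hk'.2.1) (not_le.2 hk'.2.2)

/-! ### A measurable Bolzano–Weierstrass theorem -/

section BolzanoWeierstrass

variable {V : Type*} [MetricSpace V] [MeasurableSpace V] [BorelSpace V]

theorem measurableSet_frequently_atTop {p : Ω → ℕ → Prop} (hp : ∀ n, MeasurableSet {ω | p ω n}) :
    MeasurableSet {ω | ∃ᶠ n in atTop, p ω n} := by
  simp only [frequently_atTop, Set.ofPred_forall, Set.ofPred_exists, Set.ofPred_and]
  exact MeasurableSet.iInter fun a => MeasurableSet.iUnion fun b =>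
    (MeasurableSet.const _).inter (hp b)

/-- Pigeonhole: finitely many balls of radius `ε / 2` cover `K`, so one of them is visited
infinitely often along `p`. Its index is chosen measurably, and `p'` keeps the visits to it. -/
theorem exists_measurable_frequently_dist_lt [TopologicalSpace.SeparableSpace V] {K : Set V}
    (hK : IsCompact K) {x : ℕ → Ω → V} (hx : ∀ n, Measurable (x n)) (hxK : ∀ n ω, x n ω ∈ K)
    {p : Ω → ℕ → Prop} (hp : ∀ n, MeasurableSet {ω | p ω n}) (hf : ∀ ω, ∃ᶠ n in atTop, p ω n)
    {ε : ℝ} (hε : 0 < ε) :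
    ∃ p' : Ω → ℕ → Prop, (∀ n, MeasurableSet {ω | p' ω n}) ∧ (∀ ω, ∃ᶠ n in atTop, p' ω n) ∧
      ∀ ω n, p' ω n → p ω n ∧ ∀ m, p' ω m → dist (x n ω) (x m ω) < ε := by
  rcases isEmpty_or_nonempty Ω with hΩ | ⟨⟨ω₀⟩⟩
  · exact ⟨p, hp, hf, fun ω => hΩ.elim ω⟩
  have : Nonempty V := ⟨x 0 ω₀⟩
  let q := TopologicalSpace.denseSeq V
  obtain ⟨t, ht⟩ := hK.elim_finite_subcover (fun k => Metric.ball (q k) (ε / 2))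
    (fun _ => Metric.isOpen_ball) fun v _ => by
      obtain ⟨k, hk⟩ := (TopologicalSpace.denseRange_denseSeq V).exists_dist_lt v (half_pos hε)
      exact Set.mem_iUnion.2 ⟨k, hk⟩
  have hball : ∀ k n, MeasurableSet {ω | p ω n ∧ x n ω ∈ Metric.ball (q k) (ε / 2)} := fun k n =>
    (hp n).inter (hx n Metric.isOpen_ball.measurableSet)
  obtain ⟨j, hj, hjf⟩ := exists_measurable_nat_choice
    (p := fun ω k => ∃ᶠ n in atTop, p ω n ∧ x n ω ∈ Metric.ball (q k) (ε / 2))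
    fun k => measurableSet_frequently_atTop (hball k)
  refine ⟨fun ω n => p ω n ∧ x n ω ∈ Metric.ball (q (j ω)) (ε / 2), fun n => ?_, fun ω => ?_,
    fun ω n hn => ⟨hn.1, fun m hm => ?_⟩⟩
  · have : {ω | p ω n ∧ x n ω ∈ Metric.ball (q (j ω)) (ε / 2)} =
        ⋃ k, j ⁻¹' {k} ∩ {ω | p ω n ∧ x n ω ∈ Metric.ball (q k) (ε / 2)} := by
      ext ω
      simp
    rw [this]
    exact MeasurableSet.iUnion fun k => (hj (measurableSet_singleton k)).inter (hball k n)
  · apply hjf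
    by_contra! hno
    have hev : ∀ᶠ n in atTop, ∀ k ∈ t, ¬ (p ω n ∧ x n ω ∈ Metric.ball (q k) (ε / 2)) :=
      (eventually_all_finset t).2 fun k _ => not_frequently.1 (by simpa using hno k)
    obtain ⟨n, hn, hn'⟩ := ((hf ω).and_eventually hev).exists
    obtain ⟨k, hk, hmem⟩ := Set.mem_iUnion₂.1 (ht (hxK n ω))
    exact hn' k hk ⟨hn, hmem⟩
  · calc dist (x n ω) (x m ω) ≤ dist (x n ω) (q (j ω)) + dist (x m ω) (q (j ω)) :=
          dist_triangle_right _ _ _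
      _ < ε / 2 + ε / 2 := add_lt_add hn.2 hm.2
      _ = ε := add_halves ε

/-- Measurable sequences in a compact set have convergent subsequences with measurable indices. -/
theorem exists_measurable_subseq_tendsto [TopologicalSpace.SeparableSpace V] [CompleteSpace V]
    {K : Set V} (hK : IsCompact K)
    {x : ℕ → Ω → V} (hx : ∀ n, Measurable (x n)) (hxK : ∀ n ω, x n ω ∈ K) :
    ∃ (n : ℕ → Ω → ℕ) (y : Ω → V), (∀ j, Measurable (n j)) ∧ (∀ j ω, j ≤ n j ω) ∧
      Measurable y ∧ (∀ ω, y ω ∈ K) ∧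
      ∀ ω, Tendsto (fun j => x (n j ω) ω) atTop (𝓝 (y ω)) := by
  let S := {p : Ω → ℕ → Prop //
    (∀ n, MeasurableSet {ω | p ω n}) ∧ ∀ ω, ∃ᶠ n in atTop, p ω n}
  have hstep : ∀ (k : ℕ) (s : S), ∃ s' : S, ∀ ω n, s'.1 ω n →
      s.1 ω n ∧ ∀ m, s'.1 ω m → dist (x n ω) (x m ω) < 1 / ((k : ℝ) + 1) := fun k s => by
    obtain ⟨p', h1, h2, h3⟩ := exists_measurable_frequently_dist_lt hK hx hxK s.2.1 s.2.2
      (ε := 1 / ((k : ℝ) + 1)) (by positivity)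
    exact ⟨⟨p', h1, h2⟩, h3⟩
  choose next hnext using hstep
  -- Nested infinite index sets: on stage `k + 1` the points lie within `1 / (k + 1)` of each other.
  -- The diagonal choice `n j` below is taken from stage `j + 1`, so all its terms from `N` on lie
  -- in stage `N + 1`.
  let s : ℕ → S := fun k => Nat.rec
    ⟨fun _ _ => True, fun _ => MeasurableSet.const _, fun _ => Frequently.of_forall fun _ => trivial⟩
    next k
  have hs : ∀ k ω n, (s (k + 1)).1 ω n →
      (s k).1 ω n ∧ ∀ m, (s (k + 1)).1 ω m → dist (x n ω) (x m ω) < 1 / ((k : ℝ) + 1) :=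
    fun k => hnext k (s k)
  have hanti : ∀ ω n, Antitone fun k => (s k).1 ω n := fun ω n =>
    antitone_nat_of_succ_le fun k h => (hs k ω n h).1
  have hchoice : ∀ j, ∃ n : Ω → ℕ, Measurable n ∧ ∀ ω, j ≤ n ω ∧ (s (j + 1)).1 ω (n ω) :=
    fun j => by
      obtain ⟨n, hn, h⟩ := exists_measurable_nat_choice
        (p := fun ω n => j ≤ n ∧ (s (j + 1)).1 ω n)
        fun n => (MeasurableSet.const _).inter ((s (j + 1)).2.1 n)
      exact ⟨n, hn, fun ω => h ω (frequently_atTop.1 ((s (j + 1)).2.2 ω) j)⟩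
  choose n hn hnj using hchoice
  have hlim : ∀ ω, ∃ v, Tendsto (fun j => x (n j ω) ω) atTop (𝓝 v) := fun ω =>
    cauchySeq_tendsto_of_complete <| cauchySeq_of_le_tendsto_0 (fun N : ℕ => 1 / ((N : ℝ) + 1))
      (fun i j N hi hj => ((hs N ω (n i ω) (hanti ω _ (Nat.add_le_add_right hi 1) (hnj i ω).2)).2 (n j ω)
        (hanti ω _ (Nat.add_le_add_right hj 1) (hnj j ω).2)).le) tendsto_one_div_add_atTop_nhds_zero_nat
  choose y hy using hlim
  refine ⟨n, y, hn, fun j ω => (hnj j ω).1, ?_, fun ω => ?_, hy⟩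
  · refine measurable_of_tendsto_metrizable (f := fun j ω => x (n j ω) ω) (fun j => ?_)
      (tendsto_pi_nhds.2 hy)
    exact measurable_from_prod_countable_right (f := fun a : ℕ × Ω => x a.1 a.2) hx |>.comp
      ((hn j).prodMk measurable_id)
  · exact hK.isClosed.mem_of_tendsto (hy ω) (Eventually.of_forall fun j => hxK _ _)

end BolzanoWeierstrass

/-! ### Sequential continuity almost everywhere -/

/-- Continuity only controls points that are close to `y` on all of `Ω`. Past a random time `N`
every `x n` is `δ`-close to `y`; gluing the `x n` at a random index beyond `N` where the image is
worst gives one point that is close everywhere, and continuity there controls all later indices at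
once. -/
theorem IsStableMap.tendsto_ae {E F : Set (L0E P d)} {f : E → F} (hf : IsStableMap f)
    (hfc : IsTcContinuous f) {x : ℕ → E} {y : E}
    (h : ∀ᵐ ω ∂P, Tendsto (fun n => (x n).1 ω) atTop (𝓝 (y.1 ω))) :
    ∀ᵐ ω ∂P, Tendsto (fun n => (f (x n)).1 ω) atTop (𝓝 ((f y).1 ω)) := by
  suffices H : ∀ m : ℕ, ∀ᵐ ω ∂P, ∃ N, ∀ n, N ≤ n →
      ‖(f y).1 ω - (f (x n)).1 ω‖ < 1 / ((m : ℝ) + 1) by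
    filter_upwards [ae_all_iff.2 H] with ω hω
    rw [Metric.tendsto_atTop]
    intro ε hε
    obtain ⟨m, hm⟩ := exists_nat_one_div_lt hε
    obtain ⟨N, hN⟩ := hω m
    refine ⟨N, fun n hn => ?_⟩
    rw [dist_comm, dist_eq_norm]
    exact (hN n hn).trans hm
  intro m
  have hε : 0 < 1 / ((m : ℝ) + 1) := by positivity
  set ε := 1 / ((m : ℝ) + 1)
  have hεc := AEEqFun.coeFn_const Ω (μ := P) ε
  obtain ⟨δ, hδ, hδf⟩ := isTcContinuous_iff.1 hfc y (AEEqFun.const Ω ε) (by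
    filter_upwards [hεc] with ω h
    rw [h]
    exact hε)
  obtain ⟨N, hN, hNδ⟩ := exists_measurable_nat_choice
    (p := fun ω k => ∀ n, k ≤ n → ‖y.1 ω - (x n).1 ω‖ < δ ω) fun k => by
      simp only [Set.ofPred_forall]
      exact MeasurableSet.iInter fun n => MeasurableSet.iInter fun _ =>
        measurableSet_lt (y.1.measurable.sub (x n).1.measurable).norm δ.measurable
  have hgm : ∀ n, Measurable fun ω => ‖(f y).1 ω - (f (x n)).1 ω‖ := fun n =>
    ((f y).1.measurable.sub (f (x n)).1.measurable).norm
  have hNm : ∀ n, MeasurableSet {ω | N ω ≤ n} := fun n => measurableSet_le hN measurable_const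
  have hall : MeasurableSet {ω | ∀ n, N ω ≤ n → ‖(f y).1 ω - (f (x n)).1 ω‖ < ε} := by
    simp only [Set.ofPred_forall]
    exact MeasurableSet.iInter fun n => (hNm n).imp (measurableSet_lt (hgm n) measurable_const)
  -- `k ω` is an index beyond `N ω` violating the `ε`-bound whenever one exists.
  obtain ⟨k, hk, hkN⟩ := exists_measurable_nat_choice
    (p := fun ω n => N ω ≤ n ∧ (ε ≤ ‖(f y).1 ω - (f (x n)).1 ω‖ ∨
      ∀ n, N ω ≤ n → ‖(f y).1 ω - (f (x n)).1 ω‖ < ε)) fun n =>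
      (hNm n).inter ((measurableSet_le measurable_const (hgm n)).union hall)
  have hkN' : ∀ ω, N ω ≤ k ω ∧ (ε ≤ ‖(f y).1 ω - (f (x (k ω))).1 ω‖ ∨
      ∀ n, N ω ≤ n → ‖(f y).1 ω - (f (x n)).1 ω‖ < ε) := fun ω => by
    apply hkN
    by_cases hc : ∀ n, N ω ≤ n → ‖(f y).1 ω - (f (x n)).1 ω‖ < ε
    · exact ⟨N ω, le_rfl, Or.inr hc⟩
    · push Not at hc
      exact hc.imp fun n hn => ⟨hn.1, Or.inl hn.2⟩
  obtain ⟨z, hz⟩ := hf.exists_glue x hk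
  have hclose : ∀ᵐ ω ∂P, ‖y.1 ω - z.1 ω‖ < δ ω := by
    filter_upwards [h, hδ, hz] with ω h1 h2 h3
    rw [h3.1]
    refine hNδ ω ?_ (k ω) (hkN' ω).1
    obtain ⟨M, hM⟩ := Metric.tendsto_atTop.1 h1 (δ ω) h2
    refine ⟨M, fun n hn => ?_⟩
    rw [← dist_eq_norm, dist_comm]
    exact hM n hn
  filter_upwards [hδf z hclose, hz, hεc] with ω h1 h2 h3
  rw [h2.2, h3] at h1
  exact ⟨N ω, (hkN' ω).2.resolve_left (not_le.2 h1)⟩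

theorem IsStableMap.tendsto_ae_glue {E F : Set (L0E P d)} {f : E → F} (hf : IsStableMap f)
    (hfc : IsTcContinuous f) {x : ℕ → E} {y : E} {k : ℕ → Ω → ℕ} (hk : ∀ j, Measurable (k j))
    (h : ∀ᵐ ω ∂P, Tendsto (fun j => (x (k j ω)).1 ω) atTop (𝓝 (y.1 ω))) :
    ∀ᵐ ω ∂P, Tendsto (fun j => (f (x (k j ω))).1 ω) atTop (𝓝 ((f y).1 ω)) := by
  choose z hz using fun j => hf.exists_glue x (hk j)
  have hz' := ae_all_iff.2 hz
  have := hf.tendsto_ae hfc (x := z) (y := y) (by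
    filter_upwards [h, hz'] with ω h1 h2
    simpa only [(h2 _).1] using h1)
  filter_upwards [this, hz'] with ω h1 h2
  simpa only [(h2 _).2] using h1

/-! ### The retraction along rays -/

section Ray

variable {V : Type*} [NormedAddCommGroup V] [InnerProductSpace ℝ V]

/-- The smaller solution `λ` of `‖u + λ (v - u)‖ = 1`. -/
noncomputable def rayParam (u v : V) : ℝ :=
  (inner ℝ u (u - v) - √(inner ℝ u (u - v) ^ 2 + ‖u - v‖ ^ 2 * (1 - ‖u‖ ^ 2))) / ‖v - u‖ ^ 2

/-- Square the norm, multiply by `‖v - u‖ ^ 2` and complete the square. -/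
theorem norm_add_smul_sub_eq_one_iff {u v : V} (huv : u ≠ v) (t : ℝ) :
    ‖u + t • (v - u)‖ = 1 ↔ (‖v - u‖ ^ 2 * t - inner ℝ u (u - v)) ^ 2 =
      inner ℝ u (u - v) ^ 2 + ‖u - v‖ ^ 2 * (1 - ‖u‖ ^ 2) := by
  have ha : 0 < ‖v - u‖ ^ 2 := pow_pos (norm_pos_iff.2 (sub_ne_zero.2 huv.symm)) 2
  have h1 : ‖u + t • (v - u)‖ ^ 2 = ‖u‖ ^ 2 - 2 * t * inner ℝ u (u - v) + t ^ 2 * ‖v - u‖ ^ 2 := by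
    rw [norm_add_sq_real, inner_smul_right, norm_smul, mul_pow, Real.norm_eq_abs, sq_abs,
      ← neg_sub u v, inner_neg_right]
    ring
  rw [← pow_eq_one_iff_of_nonneg (norm_nonneg _) two_ne_zero, h1, norm_sub_rev u v,
    ← mul_right_inj' ha.ne']
  constructor <;> intro h <;> linear_combination h

theorem norm_add_rayParam_smul {u v : V} (hu : ‖u‖ ≤ 1) (huv : u ≠ v) :
    ‖u + rayParam u v • (v - u)‖ = 1 := by
  have ha : ‖v - u‖ ^ 2 ≠ 0 := (pow_pos (norm_pos_iff.2 (sub_ne_zero.2 huv.symm)) 2).ne'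
  have hc : 0 ≤ 1 - ‖u‖ ^ 2 := sub_nonneg.2 (pow_le_one₀ (norm_nonneg _) hu)
  rw [norm_add_smul_sub_eq_one_iff huv, rayParam, mul_div_cancel₀ _ ha, sub_sub_cancel_left,
    neg_sq, Real.sq_sqrt (by positivity)]

theorem rayParam_le {u v : V} (huv : u ≠ v) {t : ℝ}
    (ht : ‖u + t • (v - u)‖ = 1) : rayParam u v ≤ t := by
  have ha : 0 < ‖v - u‖ ^ 2 := pow_pos (norm_pos_iff.2 (sub_ne_zero.2 huv.symm)) 2
  rw [norm_add_smul_sub_eq_one_iff huv] at ht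
  rw [rayParam, div_le_iff₀ ha, ← ht, Real.sqrt_sq_eq_abs]
  linarith [neg_abs_le (‖v - u‖ ^ 2 * t - inner ℝ u (u - v))]

/-- For `u` on the sphere the root is `|⟨u, u - v⟩|`, and `⟨u, u - v⟩ = 1 - ⟨u, v⟩ ≥ 0` by
Cauchy–Schwarz. This is why the retraction fixes the sphere. -/
theorem rayParam_eq_zero {u v : V} (hu : ‖u‖ = 1) (hv : ‖v‖ ≤ 1) : rayParam u v = 0 := by
  have h : 0 ≤ inner ℝ u (u - v) := by
    have := real_inner_le_norm u v
    rw [inner_sub_right, real_inner_self_eq_norm_sq, hu]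
    rw [hu] at this
    linarith
  rw [rayParam, hu, one_pow, sub_self, mul_zero, add_zero, Real.sqrt_sq h, sub_self, zero_div]

theorem continuousOn_rayParam :
    ContinuousOn (fun z : V × V => rayParam z.1 z.2) {z | z.1 ≠ z.2} := by
  unfold rayParam
  refine ContinuousOn.div (Continuous.continuousOn (by fun_prop))
    (Continuous.continuousOn (by fun_prop)) fun z hz => ?_
  exact pow_ne_zero 2 (norm_ne_zero_iff.2 (sub_ne_zero.2 (Ne.symm hz)))

theorem measurable_rayParam [MeasurableSpace V] [BorelSpace V] [SecondCountableTopology V]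
    {f g : Ω → V} (hf : Measurable f) (hg : Measurable g) :
    Measurable fun ω => rayParam (f ω) (g ω) := by
  have h : Measurable fun z : V × V => rayParam z.1 z.2 := by
    unfold rayParam
    refine Measurable.div (Continuous.measurable (by fun_prop)) (Continuous.measurable (by fun_prop))
  exact h.comp (hf.prodMk hg)

end Ray

theorem mem_unitBall_iff {x : L0E P d} : x ∈ unitBall P d ↔ ∀ᵐ ω ∂P, ‖x ω‖ ≤ 1 := by
  simp [unitBall, L0Set]

theorem mem_unitSphere_iff {x : L0E P d} : x ∈ unitSphere P d ↔ ∀ᵐ ω ∂P, ‖x ω‖ = 1 := by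
  simp [unitSphere, L0Set]

theorem isSigmaStable_unitBall : IsSigmaStable (unitBall P d) := isSigmaStable_L0Set _

theorem isSigmaStable_unitSphere : IsSigmaStable (unitSphere P d) := isSigmaStable_L0Set _

theorem unitSphere_subset_unitBall : unitSphere P d ⊆ unitBall P d := fun _ hx =>
  mem_unitBall_iff.2 ((mem_unitSphere_iff.1 hx).mono fun _ h => h.le)

theorem mem_lineSphereParams_iff {x y : L0E P d} {l : L0 P} :
    l ∈ lineSphereParams x y ↔ ∀ᵐ ω ∂P, ‖x ω + l ω • (y ω - x ω)‖ = 1 := by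
  rw [lineSphereParams, Set.mem_ofPred_eq, AEEqFun.ext_iff]
  apply eventually_congr
  filter_upwards [coeFn_norm0 (x + smul0 l (y - x)), AEEqFun.coeFn_add x (smul0 l (y - x)),
    coeFn_smul0 l (y - x), AEEqFun.coeFn_sub y x,
    AEEqFun.coeFn_one (α := Ω) (μ := P) (β := ℝ)] with ω h1 h2 h3 h4 h5
  rw [h1, h2, Pi.add_apply, h3, h4, h5, Pi.sub_apply, Pi.one_apply]

theorem exists_retraction_of_forall_ne {D : Set (L0E P d)} (hSD : unitSphere P d ⊆ D)
    (hDB : D ⊆ unitBall P d) (hD : IsSigmaStable D) (f : D → unitBall P d)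
    (hf : IsStableMap f) (hfc : IsTcContinuous f)
    (hne : ∀ x : D, LtOnΩ 0 (norm0 ((f x : L0E P d) - (x : L0E P d)))) :
    ∃ (l : D → L0 P) (h : D → unitSphere P d),
      (∀ x : D, IsLeast (lineSphereParams (x : L0E P d) (f x)) (l x)) ∧
      (∀ x : D, ∀ᵐ ω ∂P, l x ω = rayParam (x.1 ω) ((f x).1 ω)) ∧
      (∀ x : D, (h x : L0E P d) =
        (x : L0E P d) + smul0 (l x) ((f x : L0E P d) - (x : L0E P d))) ∧
      IsTcRetraction hSD h := by
  have hne' : ∀ x : D, ∀ᵐ ω ∂P, x.1 ω ≠ (f x).1 ω := fun x =>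
    ((ltOnΩ_zero_norm0_sub_iff _ _).1 (hne x)).mono fun _ h => h.symm
  have hm : ∀ x : D, Measurable fun ω => rayParam (x.1 ω) ((f x).1 ω) := fun x =>
    measurable_rayParam x.1.measurable (f x).1.measurable
  let l : D → L0 P := fun x => AEEqFun.mk _ (hm x).aestronglyMeasurable
  have hl : ∀ x : D, ∀ᵐ ω ∂P, l x ω = rayParam (x.1 ω) ((f x).1 ω) := fun x =>
    AEEqFun.coeFn_mk _ _
  let h₀ : D → L0E P d := fun x => x.1 + smul0 (l x) ((f x).1 - x.1)
  have hh₀ : ∀ x : D, ∀ᵐ ω ∂P, h₀ x ω =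
      x.1 ω + rayParam (x.1 ω) ((f x).1 ω) • ((f x).1 ω - x.1 ω) := fun x => by
    filter_upwards [AEEqFun.coeFn_add x.1 (smul0 (l x) ((f x).1 - x.1)),
      coeFn_smul0 (l x) ((f x).1 - x.1), AEEqFun.coeFn_sub (f x).1 x.1, hl x] with ω h1 h2 h3 h4
    rw [h1, Pi.add_apply, h2, h3, h4, Pi.sub_apply]
  have hray : ∀ x : D, ∀ᵐ ω ∂P,
      ‖x.1 ω + rayParam (x.1 ω) ((f x).1 ω) • ((f x).1 ω - x.1 ω)‖ = 1 := fun x => by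
    filter_upwards [hne' x, mem_unitBall_iff.1 (hDB x.2)] with ω h1 h2
    exact norm_add_rayParam_smul h2 h1
  let h : D → unitSphere P d := fun x => ⟨h₀ x, mem_unitSphere_iff.2 <| by
    filter_upwards [hh₀ x, hray x] with ω h1 h2
    rw [h1, h2]⟩
  have hsc : IsStableMap h ∧ IsTcContinuous h :=
    stable_continuous_of_pointwise hf hfc
      (isOpen_ne_fun continuous_fst continuous_snd)
      (H := fun z => z.1 + rayParam z.1 z.2 • (z.2 - z.1))
      (continuousOn_fst.add
        (continuousOn_rayParam.smul (continuousOn_snd.sub continuousOn_fst)))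
      fun x => (hne' x).and (hh₀ x)
  refine ⟨l, h, fun x => ⟨?_, fun t ht => ?_⟩, hl, fun x => rfl, isSigmaStable_unitSphere, hD,
    hsc.1, hsc.2, fun x => Subtype.ext (AEEqFun.ext ?_)⟩
  · rw [mem_lineSphereParams_iff]
    filter_upwards [hl x, hray x] with ω h1 h2
    rw [h1, h2]
  · rw [mem_lineSphereParams_iff] at ht
    rw [← AEEqFun.coeFn_le]
    filter_upwards [hl x, ht, hne' x] with ω h1 h2 h3
    rw [h1]
    exact rayParam_le h3 h2
  · filter_upwards [hh₀ (Set.inclusion hSD x), mem_unitSphere_iff.1 x.2,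
      mem_unitBall_iff.1 (f (Set.inclusion hSD x)).2] with ω h1 h2 h3
    refine h1.trans ?_
    rw [rayParam_eq_zero h2 h3, zero_smul, add_zero]

/-! ### From random to deterministic maps of the ball -/

/-- The constant random vector with value `v` in the unit ball. -/
noncomputable def constBall (P : Measure Ω) {d : ℕ}
    (v : Metric.closedBall (0 : EuclideanSpace ℝ (Fin d)) 1) : unitBall P d :=
  ⟨AEEqFun.const Ω v.1, (AEEqFun.coeFn_const Ω v.1).mono fun ω h => by rw [h]; exact v.2⟩

theorem coeFn_constBall (v : Metric.closedBall (0 : EuclideanSpace ℝ (Fin d)) 1) :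
    ∀ᵐ ω ∂P, (constBall P v).1 ω = v := AEEqFun.coeFn_const Ω v.1

/-- Along measurable sequences of points of a sequence `q` in the ball, a stable `T_c`-continuous
map has a random limit point. -/
theorem exists_random_limit {f : unitBall P d → unitBall P d} (hf : IsStableMap f)
    (hfc : IsTcContinuous f) (q : ℕ → Metric.closedBall (0 : EuclideanSpace ℝ (Fin d)) 1)
    {k : ℕ → Ω → ℕ} (hk : ∀ n, Measurable (k n)) :
    ∃ (n : ℕ → Ω → ℕ) (y : unitBall P d), (∀ j, Measurable (n j)) ∧ (∀ j ω, j ≤ n j ω) ∧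
      ∀ (l : ℕ → Ω → ℕ), (∀ n, Measurable (l n)) →
        (∀ n ω, dist (q (k n ω)) (q (l n ω)) ≤ 1 / ((n : ℝ) + 1)) →
        ∀ᵐ ω ∂P, Tendsto (fun j => (q (l (n j ω) ω)).1) atTop (𝓝 (y.1 ω)) ∧
          Tendsto (fun j => (f (constBall P (q (l (n j ω) ω)))).1 ω) atTop (𝓝 ((f y).1 ω)) := by
  obtain ⟨n, y, hn, hjn, hy, hyK, hlim⟩ := exists_measurable_subseq_tendsto
    (isCompact_closedBall (0 : EuclideanSpace ℝ (Fin d)) 1)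
    (x := fun n ω => (q (k n ω)).1) (fun n => (measurable_from_top (f := fun i => (q i).1)).comp (hk n))
    fun n ω => (q (k n ω)).2
  have hyae := AEEqFun.coeFn_mk (μ := P) y hy.aestronglyMeasurable
  refine ⟨n, ⟨AEEqFun.mk y hy.aestronglyMeasurable, hyae.mono fun ω h => by rw [h]; exact hyK ω⟩,
    hn, hjn, fun l hl hkl => ?_⟩
  -- Any `l` staying within `1 / (n + 1)` of `k` has the same limit along the subsequence, since `j
  -- ≤ n j ω`.
  have hlim' : ∀ ω, Tendsto (fun j => (q (l (n j ω) ω)).1) atTop (𝓝 (y ω)) := fun ω => by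
    refine (tendsto_iff_of_dist ?_).1 (hlim ω)
    refine squeeze_zero (fun _ => dist_nonneg) (fun j => ?_)
      (tendsto_one_div_add_atTop_nhds_zero_nat (𝕜 := ℝ))
    refine (hkl (n j ω) ω).trans ?_
    have := hjn j ω
    gcongr
  have hmeas : ∀ j, Measurable fun ω => l (n j ω) ω := fun j =>
    (measurable_from_prod_countable_right (f := fun a : ℕ × Ω => l a.1 a.2) hl).comp
      ((hn j).prodMk measurable_id)
  have hc : ∀ᵐ ω ∂P, ∀ i, (constBall P (q i)).1 ω = q i :=
    ae_all_iff.2 fun i => coeFn_constBall (q i)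
  refine Eventually.and (hyae.mono fun ω h => by rw [h]; exact hlim' ω) ?_
  refine hf.tendsto_ae_glue hfc (x := fun i => constBall P (q i)) hmeas ?_
  filter_upwards [hyae, hc] with ω h1 h2
  simpa only [h2, h1] using hlim' ω

/-- Heine–Cantor by contradiction: pairs ever closer together whose images stay `ε` apart would,
chosen measurably, have a common random limit along a subsequence, against continuity. -/
theorem ae_uniform_on_seq {f : unitBall P d → unitBall P d} (hf : IsStableMap f)
    (hfc : IsTcContinuous f) (q : ℕ → Metric.closedBall (0 : EuclideanSpace ℝ (Fin d)) 1)
    {ε : ℝ} (hε : 0 < ε) :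
    ∀ᵐ ω ∂P, ∃ n : ℕ, ∀ k l, dist (q k) (q l) ≤ 1 / ((n : ℝ) + 1) →
      dist ((f (constBall P (q k))).1 ω) ((f (constBall P (q l))).1 ω) < ε := by
  let φ : ℕ → Ω → EuclideanSpace ℝ (Fin d) := fun k => (f (constBall P (q k))).1
  have hφ : ∀ k l, Measurable fun ω => dist (φ k ω) (φ l ω) := fun k l =>
    (f (constBall P (q k))).1.measurable.dist (f (constBall P (q l))).1.measurable
  have hgood : ∀ n : ℕ, MeasurableSet {ω | ∀ k l, dist (q k) (q l) ≤ 1 / ((n : ℝ) + 1) →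
      dist (φ k ω) (φ l ω) < ε} := fun n => by
    simp only [Set.ofPred_forall]
    exact MeasurableSet.iInter fun k => MeasurableSet.iInter fun l => MeasurableSet.iInter fun _ =>
      measurableSet_lt (hφ k l) measurable_const
  -- `m` encodes a pair of indices: a violating pair at scale `1 / (n + 1)` if there is one,
  -- otherwise any admissible pair.
  have hchoice := fun n : ℕ => exists_measurable_nat_choice
    (p := fun ω m => dist (q m.unpair.1) (q m.unpair.2) ≤ 1 / ((n : ℝ) + 1) ∧
      (ε ≤ dist (φ m.unpair.1 ω) (φ m.unpair.2 ω) ∨ ∀ k l, dist (q k) (q l) ≤ 1 / ((n : ℝ) + 1) →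
        dist (φ k ω) (φ l ω) < ε))
    fun m => (MeasurableSet.const _).inter
      ((measurableSet_le measurable_const (hφ _ _)).union (hgood n))
  choose m hm hmspec using hchoice
  have hmspec' : ∀ (n : ℕ) ω, _ := fun n ω => hmspec n ω <| by
    by_cases hc : ∀ k l, dist (q k) (q l) ≤ 1 / ((n : ℝ) + 1) → dist (φ k ω) (φ l ω) < ε
    · refine ⟨Nat.pair 0 0, ?_, Or.inr hc⟩
      rw [Nat.unpair_pair, dist_self]
      positivity
    · push Not at hc
      obtain ⟨k, l, h1, h2⟩ := hc
      refine ⟨Nat.pair k l, ?_⟩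
      rw [Nat.unpair_pair]
      exact ⟨h1, Or.inl h2⟩
  have hk : ∀ n, Measurable fun ω => (m n ω).unpair.1 := fun n =>
    (measurable_from_top (f := fun i : ℕ => i.unpair.1)).comp (hm n)
  have hl : ∀ n, Measurable fun ω => (m n ω).unpair.2 := fun n =>
    (measurable_from_top (f := fun i : ℕ => i.unpair.2)).comp (hm n)
  obtain ⟨n, y, -, -, H⟩ := exists_random_limit hf hfc q hk
  filter_upwards [H _ hk fun n ω => by rw [dist_self]; positivity,
    H _ hl fun n ω => (hmspec' n ω).1] with ω h1 h2
  have h3 := h1.2.dist h2.2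
  rw [dist_self] at h3
  obtain ⟨j, hj⟩ := (h3.eventually (gt_mem_nhds hε)).exists
  exact ⟨n j ω, (hmspec' (n j ω) ω).2.resolve_left (not_le.2 hj)⟩

/-- A random limit point of measurably chosen approximate fixed points is a fixed point. -/
theorem exists_eq_of_ae_approx {f : unitBall P d → unitBall P d} (hf : IsStableMap f)
    (hfc : IsTcContinuous f) (q : ℕ → Metric.closedBall (0 : EuclideanSpace ℝ (Fin d)) 1)
    (h : ∀ᵐ ω ∂P, ∀ n : ℕ, ∃ k,
      dist ((f (constBall P (q k))).1 ω) (q k) < 1 / ((n : ℝ) + 1)) :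
    ∃ x, f x = x := by
  have hchoice := fun n : ℕ => exists_measurable_nat_choice
    (p := fun ω k => dist ((f (constBall P (q k))).1 ω) (q k) < 1 / ((n : ℝ) + 1))
    fun k => measurableSet_lt ((f (constBall P (q k))).1.measurable.dist measurable_const)
      measurable_const
  choose k hk hkspec using hchoice
  obtain ⟨n, y, -, hjn, H⟩ := exists_random_limit hf hfc q hk
  refine ⟨y, Subtype.ext (AEEqFun.ext ?_)⟩
  filter_upwards [h, H _ hk fun n ω => by rw [dist_self]; positivity] with ω h1 h2
  refine tendsto_nhds_unique h2.2 ((tendsto_iff_of_dist ?_).1 h2.1)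
  refine squeeze_zero (fun _ => dist_nonneg) (fun j => ?_)
    (tendsto_one_div_add_atTop_nhds_zero_nat (𝕜 := ℝ))
  rw [dist_comm]
  refine (hkspec (n j ω) ω (h1 _)).le.trans ?_
  have := hjn j ω
  gcongr

/-- If the random Brouwer theorem fails for the ball, so does the deterministic one. -/
theorem exists_continuousMap_ne_of_not_randomBrouwerBall (h : ¬ RandomBrouwerBall P d) :
    ∃ G : C(EuclideanSpace ℝ (Fin d), EuclideanSpace ℝ (Fin d)),
      ∀ v, ‖v‖ ≤ 1 → ‖G v‖ ≤ 1 ∧ G v ≠ v := by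
  unfold RandomBrouwerBall at h
  push Not at h
  obtain ⟨f, hf, hfc, hno⟩ := h
  have : Nonempty (Metric.closedBall (0 : EuclideanSpace ℝ (Fin d)) 1) :=
    ⟨⟨0, by simp⟩⟩
  let q := TopologicalSpace.denseSeq (Metric.closedBall (0 : EuclideanSpace ℝ (Fin d)) 1)
  have hq : Dense (Set.range q) := TopologicalSpace.denseRange_denseSeq _
  have hfreq : ∃ᵐ ω ∂P, ¬ ∀ n : ℕ, ∃ k,
      dist ((f (constBall P (q k))).1 ω) (q k) < 1 / ((n : ℝ) + 1) := fun hae => by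
    obtain ⟨x, hx⟩ := exists_eq_of_ae_approx hf hfc q (hae.mono fun _ h => not_not.1 h)
    exact hno x hx
  obtain ⟨ω, hω, hunif, hball⟩ := (hfreq.and_eventually
    -- One outcome is fixed at which the slice has no approximate fixed points, is uniformly
    -- continuous and takes values in the ball; the rest is deterministic.
    ((ae_all_iff.2 fun m : ℕ => ae_uniform_on_seq hf hfc q
      (ε := 1 / ((m : ℝ) + 1)) (by positivity)).and
      (ae_all_iff.2 fun k => mem_unitBall_iff.1 (f (constBall P (q k))).2))).exists
  push Not at hω
  obtain ⟨n, hn⟩ := hω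
  let F₀ : Set.range q → EuclideanSpace ℝ (Fin d) := fun v => (f (constBall P v.1)).1 ω
  have hF₀ : UniformContinuous F₀ := by
    rw [Metric.uniformContinuous_iff]
    intro ε hε
    obtain ⟨m, hm⟩ := exists_nat_one_div_lt hε
    obtain ⟨i, hi⟩ := hunif m
    refine ⟨1 / ((i : ℝ) + 1), by positivity, ?_⟩
    rintro ⟨_, k, rfl⟩ ⟨_, l, rfl⟩ hkl
    exact (hi k l hkl.le).trans hm
  have hFc : Continuous (hq.extend F₀) := (hq.uniformContinuous_extend hF₀).continuous
  have hFq : ∀ k, hq.extend F₀ (q k) = (f (constBall P (q k))).1 ω := fun k =>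
    hq.extend_of_ind hF₀ ⟨q k, k, rfl⟩
  have hFball : ∀ v, ‖hq.extend F₀ v‖ ≤ 1 := fun v => by
    refine hq.induction (P := fun v => ‖hq.extend F₀ v‖ ≤ 1) ?_
      (isClosed_le hFc.norm continuous_const) v
    rintro _ ⟨k, rfl⟩
    rw [hFq]
    exact hball k
  have hFne : ∀ v, 1 / ((n : ℝ) + 1) ≤ dist (hq.extend F₀ v) v := fun v => by
    refine hq.induction (P := fun v => 1 / ((n : ℝ) + 1) ≤ dist (hq.extend F₀ v) v) ?_
      (isClosed_le continuous_const (hFc.dist continuous_subtype_val)) v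
    rintro _ ⟨k, rfl⟩
    rw [hFq]
    exact hn k
  -- Tietze extension to the whole space, so that `G` can be composed with arbitrary classes.
  obtain ⟨G, hG⟩ := ContinuousMap.exists_restrict_eq (Metric.isClosed_closedBall)
    (⟨hq.extend F₀, hFc⟩ : C(Metric.closedBall (0 : EuclideanSpace ℝ (Fin d)) 1, _))
  refine ⟨G, fun v hv => ?_⟩
  have hGv : G v = hq.extend F₀ ⟨v, by simpa using hv⟩ :=
    DFunLike.congr_fun hG (⟨v, by simpa using hv⟩ : Metric.closedBall _ _)
  rw [hGv]
  refine ⟨hFball _, fun heq => ?_⟩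
  have := hFne ⟨v, by simpa using hv⟩
  rw [heq, dist_self] at this
  exact absurd this (not_le.2 (by positivity))

/-- A deterministic fixed-point-free map acting pointwise moves every random vector of the ball
almost surely, which is what the ray construction needs. -/
theorem isTcRetract_of_not_randomBrouwerBall (h : ¬ RandomBrouwerBall P d) :
    IsTcRetract (unitSphere P d) (unitBall P d) := by
  obtain ⟨G, hG⟩ := exists_continuousMap_ne_of_not_randomBrouwerBall h
  have hcomp : ∀ x : L0E P d, ∀ᵐ ω ∂P, x.comp G G.continuous ω = G (x ω) := fun x =>
    AEEqFun.coeFn_comp _ _ _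
  let g : unitBall P d → unitBall P d := fun x => ⟨x.1.comp G G.continuous,
    mem_unitBall_iff.2 <| by
      filter_upwards [hcomp x.1, mem_unitBall_iff.1 x.2] with ω h1 h2
      rw [h1]
      exact (hG _ h2).1⟩
  have hid : IsStableMap (id : unitBall P d → unitBall P d) ∧
      IsTcContinuous (id : unitBall P d → unitBall P d) :=
    stable_continuous_of_lipschitz isSigmaStable_unitBall 1 fun x y => by
      filter_upwards [AEEqFun.coeFn_one (α := Ω) (μ := P) (β := ℝ)] with ω h
      simp [h]
  have hg : IsStableMap g ∧ IsTcContinuous g :=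
    stable_continuous_of_pointwise hid.1 hid.2 isOpen_univ
      (H := fun z => G z.1) (G.continuous.comp continuous_fst).continuousOn
      fun x => (hcomp x.1).mono fun ω h => ⟨trivial, h⟩
  obtain ⟨-, r, -, -, -, hr⟩ := exists_retraction_of_forall_ne unitSphere_subset_unitBall
    subset_rfl isSigmaStable_unitBall g hg.1 hg.2 fun x => by
      rw [ltOnΩ_zero_norm0_sub_iff]
      filter_upwards [hcomp x.1, mem_unitBall_iff.1 x.2] with ω h1 h2
      rw [h1]
      exact (hG _ h2).2
  exact ⟨unitSphere_subset_unitBall, r, hr⟩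

/-! ### The random metric projection -/

/-- The essential infimum of a family of nonnegative functions is attained along a sequence. -/
theorem exists_seq_ae_iInf_le [IsFiniteMeasure P] {ι : Type*} [Nonempty ι] {u : ι → Ω → ℝ}
    (hu : ∀ i, Measurable (u i)) (hu0 : ∀ i ω, 0 ≤ u i ω) :
    ∃ s : ℕ → ι, ∀ i, ∀ᵐ ω ∂P, ⨅ n, u (s n) ω ≤ u i ω := by
  have hbdd : ∀ (s : ℕ → ι) ω, BddBelow (Set.range fun n => u (s n) ω) := fun s ω =>
    ⟨0, by rintro _ ⟨n, rfl⟩; exact hu0 _ _⟩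
  -- `arctan` makes the infima integrable while staying strictly increasing.
  let φ : (ℕ → ι) → Ω → ℝ := fun s ω => Real.arctan (⨅ n, u (s n) ω)
  have hint : ∀ s, Integrable (φ s) P := fun s => by
    refine Integrable.of_bound (C := Real.pi / 2) (Real.continuous_arctan.measurable.comp
      (Measurable.iInf fun n => hu (s n))).aestronglyMeasurable (Eventually.of_forall fun ω => ?_)
    exact abs_le.2 ⟨(Real.neg_pi_div_two_lt_arctan _).le, (Real.arctan_lt_pi_div_two _).le⟩
  have hJbdd : BddBelow (Set.range fun s => ∫ ω, φ s ω ∂P) := by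
    refine ⟨0, ?_⟩
    rintro _ ⟨s, rfl⟩
    exact integral_nonneg fun ω => Real.arctan_nonneg.2 (Real.iInf_nonneg fun n => hu0 _ _)
  obtain ⟨a, -, ha, has⟩ := exists_seq_tendsto_sInf (Set.range_nonempty fun s => ∫ ω, φ s ω ∂P) hJbdd
  choose s hs using has
  -- Merging a minimizing sequence of sequences into one attains the minimal integral.
  let t : ℕ → ι := fun n => s n.unpair.1 n.unpair.2
  have htle : ∀ k ω, ⨅ n, u (t n) ω ≤ ⨅ n, u (s k n) ω := fun k ω =>
    le_ciInf fun n => (ciInf_le (hbdd t ω) (Nat.pair k n)).trans_eq (by simp [t])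
  have hmin : ∀ s', ∫ ω, φ t ω ∂P ≤ ∫ ω, φ s' ω ∂P := fun s' => by
    refine le_trans (ge_of_tendsto' ha fun k => ?_) (csInf_le hJbdd ⟨s', rfl⟩)
    rw [← hs k]
    exact integral_mono (hint t) (hint (s k)) fun ω => Real.arctan_strictMono.monotone (htle k ω)
  refine ⟨t, fun i => ?_⟩
  -- Prepending `i` cannot lower the minimal integral, so the infimum is a.e. unchanged.
  let t' : ℕ → ι := fun n => Nat.casesOn n i t
  have ht' : ∀ ω, ⨅ n, u (t' n) ω ≤ ⨅ n, u (t n) ω := fun ω =>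
    le_ciInf fun n => ciInf_le (hbdd t' ω) (n + 1)
  have hle : φ t' ≤ φ t := fun ω => Real.arctan_strictMono.monotone (ht' ω)
  have heq := (integral_eq_iff_of_ae_le (hint t') (hint t) (Eventually.of_forall hle)).1
    (le_antisymm (integral_mono (hint t') (hint t) hle) (hmin t'))
  filter_upwards [heq] with ω hω
  rw [← Real.arctan_injective hω]
  exact ciInf_le (hbdd t' ω) 0

/-- Otherwise a random ball around `y` misses `G`; but gluing the `z n` at a random index where they
have entered the ball gives an element of `G` inside it. -/
theorem mem_of_tendsto_ae {G : Set (L0E P d)} (hG : IsSigmaStable G) (hGc : IsClosed[Tc P d] G)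
    {z : ℕ → G} {y : L0E P d}
    (h : ∀ᵐ ω ∂P, Tendsto (fun n => (z n).1 ω) atTop (𝓝 (y ω))) : y ∈ G := by
  by_contra hy
  let _ := Tc P d
  obtain ⟨r, hr, hrG⟩ := isOpen_Tc_iff.1 hGc.isOpen_compl y hy
  obtain ⟨n, hn, hnr⟩ := exists_measurable_nat_choice
    (p := fun ω n => ‖y ω - (z n).1 ω‖ < r ω) fun n =>
      measurableSet_lt (y.measurable.sub (z n).1.measurable).norm r.measurable
  obtain ⟨w, hw⟩ := hG.exists_glue z hn
  refine hrG (mem_randomBall_iff.2 ?_) w.2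
  filter_upwards [h, hr, hw] with ω h1 h2 h3
  rw [h3]
  refine hnr ω ?_
  obtain ⟨k, hk⟩ := (h1.eventually (Metric.ball_mem_nhds _ h2)).exists
  refine ⟨k, ?_⟩
  rw [← dist_eq_norm, dist_comm]
  exact hk

theorem IsL0Convex.exists_combination {G : Set (L0E P d)} (hG : IsL0Convex G) {x y : L0E P d}
    (hx : x ∈ G) (hy : y ∈ G) {t : ℝ} (ht0 : 0 ≤ t) (ht1 : t ≤ 1) :
    ∃ z ∈ G, ∀ᵐ ω ∂P, z ω = t • x ω + (1 - t) • y ω := by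
  have ht := AEEqFun.coeFn_const Ω (μ := P) t
  have h0 := AEEqFun.coeFn_zero (α := Ω) (μ := P) (β := ℝ)
  have h1 := AEEqFun.coeFn_one (α := Ω) (μ := P) (β := ℝ)
  refine ⟨_, hG x hx y hy (AEEqFun.const Ω t) ?_ ?_, ?_⟩
  · rw [← AEEqFun.coeFn_le]
    filter_upwards [ht, h0] with ω h1 h2
    rwa [h1, h2]
  · rw [← AEEqFun.coeFn_le]
    filter_upwards [ht, h1] with ω h1 h2
    rwa [h1, h2]
  · filter_upwards [ht, h1, AEEqFun.coeFn_add (smul0 (AEEqFun.const Ω t) x)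
      (smul0 (1 - AEEqFun.const Ω t) y), coeFn_smul0 (AEEqFun.const Ω t) x,
      coeFn_smul0 (1 - AEEqFun.const Ω t) y,
      AEEqFun.coeFn_sub (1 : L0 P) (AEEqFun.const Ω t)] with ω h1 h2 h3 h4 h5 h6
    rw [h3, Pi.add_apply, h4, h5, h6, Pi.sub_apply, h1, h2]
    rfl

/-- `p` is a point of `G` nearest to `x`, almost surely. -/
def IsNearest (G : Set (L0E P d)) (x p : L0E P d) : Prop :=
  p ∈ G ∧ ∀ z ∈ G, ∀ᵐ ω ∂P, ‖x ω - p ω‖ ≤ ‖x ω - z ω‖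

/-- The Hilbert-space argument for each `ω`: a glued minimizing sequence is Cauchy by the
parallelogram law, because midpoints stay in `G`. -/
theorem exists_isNearest [IsFiniteMeasure P] {G : Set (L0E P d)} (hne : G.Nonempty)
    (hG : IsSigmaStable G) (hGc : IsClosed[Tc P d] G) (hconv : IsL0Convex G) (x : L0E P d) :
    ∃ p, IsNearest G x p := by
  have : Nonempty G := hne.to_subtype
  have hum : ∀ y : G, Measurable fun ω => ‖x ω - y.1 ω‖ := fun y =>
    (x.measurable.sub y.1.measurable).norm
  obtain ⟨s, hs⟩ := exists_seq_ae_iInf_le (P := P) hum fun _ _ => norm_nonneg _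
  set D : Ω → ℝ := fun ω => ⨅ n, ‖x ω - (s n).1 ω‖
  have hDm : Measurable D := Measurable.iInf fun n => hum (s n)
  have hD0 : ∀ ω, 0 ≤ D ω := fun ω => Real.iInf_nonneg fun n => norm_nonneg _
  have hchoice := fun m : ℕ => exists_measurable_nat_choice
    (p := fun ω n => ‖x ω - (s n).1 ω‖ < D ω + 1 / ((m : ℝ) + 1)) fun n =>
      measurableSet_lt (hum (s n)) (hDm.add_const _)
  choose k hk hkspec using hchoice
  have hkD : ∀ m ω, ‖x ω - (s (k m ω)).1 ω‖ < D ω + 1 / ((m : ℝ) + 1) := fun m ω =>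
    hkspec m ω (exists_lt_of_ciInf_lt (lt_add_of_pos_right _ (by positivity)))
  choose z hz using fun m => hG.exists_glue s (hk m)
  choose w hwG hw using fun m l =>
    hconv.exists_combination (z m).2 (z l).2 (t := 1 / 2) (by norm_num) (by norm_num)
  have hcauchy : ∀ᵐ ω ∂P, ∃ v, Tendsto (fun m => (z m).1 ω) atTop (𝓝 v) := by
    filter_upwards [ae_all_iff.2 hz, ae_all_iff.2 fun m => ae_all_iff.2 (hw m),
      ae_all_iff.2 fun m => ae_all_iff.2 fun l => hs ⟨w m l, hwG m l⟩] with ω h1 h2 h3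
    have hzD : ∀ N m : ℕ, N ≤ m → ‖x ω - (z m).1 ω‖ ^ 2 ≤ (D ω + 1 / ((N : ℝ) + 1)) ^ 2 :=
      fun N m hm => by
        have : 1 / ((m : ℝ) + 1) ≤ 1 / ((N : ℝ) + 1) := by gcongr
        rw [h1 m]
        exact pow_le_pow_left₀ (norm_nonneg _) ((hkD m ω).le.trans (by linarith)) 2
    refine cauchySeq_tendsto_of_complete <| cauchySeq_of_le_tendsto_0
      (fun N : ℕ => √(4 * ((D ω + 1 / ((N : ℝ) + 1)) ^ 2 - D ω ^ 2))) (fun m l N hm hl => ?_) ?_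
    · refine Real.le_sqrt_of_sq_le ?_
      have hpar := parallelogram_law_with_norm_mul ℝ (x ω - (z m).1 ω) (x ω - (z l).1 ω)
      have hmid : x ω - (z m).1 ω + (x ω - (z l).1 ω) = (2 : ℝ) • (x ω - w m l ω) := by
        rw [h2 m l]
        module
      have hdiff : x ω - (z m).1 ω - (x ω - (z l).1 ω) = (z l).1 ω - (z m).1 ω := by abel
      rw [hmid, hdiff, norm_smul, Real.norm_ofNat] at hpar
      have hDw : D ω ^ 2 ≤ ‖x ω - w m l ω‖ ^ 2 := pow_le_pow_left₀ (hD0 ω) (h3 m l) 2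
      rw [dist_comm, dist_eq_norm]
      nlinarith [hzD N m hm, hzD N l hl]
    · have h := tendsto_one_div_add_atTop_nhds_zero_nat (𝕜 := ℝ)
      have := ((((h.const_add (D ω)).pow 2).sub_const (D ω ^ 2)).const_mul 4).sqrt
      simpa using this
  obtain ⟨y, hy, hlim⟩ := measurable_limit_of_tendsto_metrizable_ae
    (fun m => (z m).1.measurable.aemeasurable) hcauchy
  have hyae := AEEqFun.coeFn_mk (μ := P) y hy.aestronglyMeasurable
  refine ⟨AEEqFun.mk y hy.aestronglyMeasurable, mem_of_tendsto_ae hG hGc (z := z) ?_,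
    fun v hv => ?_⟩
  · filter_upwards [hyae, hlim] with ω h1 h2
    rwa [h1]
  · filter_upwards [hyae, hlim, ae_all_iff.2 hz, hs ⟨v, hv⟩] with ω h1 h2 h3 h4
    rw [h1]
    refine le_trans ?_ h4
    have h := (tendsto_one_div_add_atTop_nhds_zero_nat (𝕜 := ℝ)).const_add (D ω)
    rw [add_zero] at h
    refine le_of_tendsto_of_tendsto' (tendsto_const_nhds.sub h2).norm h fun m => ?_
    rw [h3 m]
    exact (hkD m ω).le

/-- First-order optimality along the segment from `p` to `z`. Steps `1 / (m + 1)` suffice, so only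
countably many null sets arise in the random version. -/
theorem inner_sub_le_zero_of_forall_norm_le {V : Type*} [NormedAddCommGroup V]
    [InnerProductSpace ℝ V] {x p z : V}
    (h : ∀ m : ℕ, ‖x - p‖ ≤ ‖x - ((1 / ((m : ℝ) + 1)) • z + (1 - 1 / ((m : ℝ) + 1)) • p)‖) :
    inner ℝ (x - p) (z - p) ≤ 0 := by
  have h2 : ∀ m : ℕ, 2 * inner ℝ (x - p) (z - p) ≤ 1 / ((m : ℝ) + 1) * ‖z - p‖ ^ 2 := fun m => by
    have ht : 0 < 1 / ((m : ℝ) + 1) := by positivity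
    have hm := h m
    set t := 1 / ((m : ℝ) + 1)
    have heq : x - (t • z + (1 - t) • p) = (x - p) - t • (z - p) := by module
    have hsq := pow_le_pow_left₀ (norm_nonneg _) hm 2
    rw [heq, norm_sub_sq_real (x - p), inner_smul_right, norm_smul, mul_pow, Real.norm_eq_abs,
      sq_abs] at hsq
    refine le_of_mul_le_mul_left ?_ ht
    linarith
  have hlim := (tendsto_one_div_add_atTop_nhds_zero_nat (𝕜 := ℝ)).mul_const (‖z - p‖ ^ 2)
  rw [zero_mul] at hlim
  linarith [ge_of_tendsto' hlim h2]

theorem IsNearest.inner_le_zero {G : Set (L0E P d)} (hconv : IsL0Convex G) {x p z : L0E P d}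
    (hp : IsNearest G x p) (hz : z ∈ G) : ∀ᵐ ω ∂P, inner ℝ (x ω - p ω) (z ω - p ω) ≤ 0 := by
  choose w hwG hw using fun m : ℕ => hconv.exists_combination hz hp.1
    (t := 1 / ((m : ℝ) + 1)) (by positivity) ((div_le_one (by positivity)).2 (by simp))
  filter_upwards [ae_all_iff.2 hw, ae_all_iff.2 fun m => hp.2 (w m) (hwG m)] with ω h1 h2
  refine inner_sub_le_zero_of_forall_norm_le fun m => ?_
  rw [← h1 m]
  exact h2 m

/-- Add the two obtuse-angle inequalities and apply Cauchy–Schwarz. -/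
theorem IsNearest.norm_sub_le {G : Set (L0E P d)} (hconv : IsL0Convex G) {x p x' p' : L0E P d}
    (hp : IsNearest G x p) (hp' : IsNearest G x' p') :
    ∀ᵐ ω ∂P, ‖p ω - p' ω‖ ≤ ‖x ω - x' ω‖ := by
  filter_upwards [hp.inner_le_zero hconv hp'.1, hp'.inner_le_zero hconv hp.1] with ω h1 h2
  have h3 := real_inner_le_norm (x ω - x' ω) (p ω - p' ω)
  have h4 : ‖p ω - p' ω‖ ^ 2 ≤ inner ℝ (x ω - x' ω) (p ω - p' ω) := by
    have h5 : inner ℝ (x ω - x' ω) (p ω - p' ω) - inner ℝ (p ω - p' ω) (p ω - p' ω) =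
        -inner ℝ (x ω - p ω) (p' ω - p ω) - inner ℝ (x' ω - p' ω) (p ω - p' ω) := by
      rw [← neg_sub (p ω) (p' ω), inner_neg_right, neg_neg, ← inner_sub_left, ← inner_sub_left]
      congr 1
      abel
    rw [real_inner_self_eq_norm_sq] at h5
    linarith
  by_contra hlt
  nlinarith [norm_nonneg (x ω - x' ω)]

/-! ### From the ball to bounded closed convex sets -/

theorem coeFn_toExt (ξ : L0 P) : ∀ᵐ ω ∂P, toExt ξ ω = (ξ ω : EReal) := AEEqFun.coeFn_comp _ _ _

theorem toExt_le_toExt_iff {ξ η : L0 P} : toExt ξ ≤ toExt η ↔ ∀ᵐ ω ∂P, ξ ω ≤ η ω := by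
  rw [← AEEqFun.coeFn_le]
  apply eventually_congr
  filter_upwards [coeFn_toExt ξ, coeFn_toExt η] with ω h1 h2
  rw [h1, h2, EReal.coe_le_coe_iff]

theorem IsASBounded.exists_bound {G : Set (L0E P d)} (hG : IsASBounded G) :
    ∃ s : L0 P, ∀ x ∈ G, ∀ᵐ ω ∂P, ‖x ω‖ ≤ s ω := by
  obtain ⟨s, -, hs⟩ := hG
  refine ⟨s, fun x hx => ?_⟩
  filter_upwards [toExt_le_toExt_iff.1 (hs.1 ⟨x, hx, rfl⟩), coeFn_norm0 x] with ω h1 h2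
  rwa [h2] at h1

theorem RandomBrouwerBall.randomBrouwerTheorem [IsFiniteMeasure P] (hB : RandomBrouwerBall P d) :
    RandomBrouwerTheorem P d := by
  intro G hne hG hbd hGc hconv f hf hfc
  obtain ⟨s, hs⟩ := hbd.exists_bound
  -- The `+ 1` makes the scaling factor invertible even where the bound vanishes.
  have hMm : Measurable fun ω => |s ω| + 1 :=
    (continuous_abs.measurable.comp s.measurable).add_const 1
  let M : L0 P := AEEqFun.mk _ hMm.aestronglyMeasurable
  let N : L0 P := AEEqFun.mk _ hMm.inv.aestronglyMeasurable
  have hM : ∀ᵐ ω ∂P, M ω = |s ω| + 1 := AEEqFun.coeFn_mk _ _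
  have hN : ∀ᵐ ω ∂P, N ω = (|s ω| + 1)⁻¹ := AEEqFun.coeFn_mk _ _
  choose π hπ using exists_isNearest hne hG hGc hconv
  let T : unitBall P d → G := fun b => ⟨π (smul0 M b.1), (hπ _).1⟩
  let U : G → unitBall P d := fun x => ⟨smul0 N x.1, mem_unitBall_iff.2 <| by
    filter_upwards [coeFn_smul0 N x.1, hN, hs x.1 x.2] with ω h1 h2 h3
    rw [h1, h2, norm_smul, norm_inv, Real.norm_of_nonneg (by positivity),
      inv_mul_le_one₀ (by positivity)]
    linarith [le_abs_self (s ω)]⟩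
  have hT : IsStableMap T ∧ IsTcContinuous T :=
    stable_continuous_of_lipschitz isSigmaStable_unitBall M fun x y => by
      filter_upwards [(hπ (smul0 M x.1)).norm_sub_le hconv (hπ (smul0 M y.1)), hM,
        coeFn_smul0 M x.1, coeFn_smul0 M y.1] with ω h1 h2 h3 h4
      rw [h3, h4, ← smul_sub, norm_smul, h2, Real.norm_of_nonneg (by positivity)] at h1
      rwa [h2]
  have hU : IsStableMap U ∧ IsTcContinuous U :=
    stable_continuous_of_lipschitz hG N fun x y => by
      filter_upwards [coeFn_smul0 N x.1, coeFn_smul0 N y.1, hN] with ω h1 h2 h3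
      refine le_of_eq ?_
      change ‖smul0 N x.1 ω - smul0 N y.1 ω‖ = _
      rw [h1, h2, ← smul_sub, norm_smul, h3, Real.norm_of_nonneg (by positivity)]
  obtain ⟨b, hb⟩ := hB (U ∘ f ∘ T) (hU.1.comp (hf.comp hT.1)) (hU.2.comp (hfc.comp hT.2))
  have hfT : (f (T b)).1 = smul0 M b.1 := by
    apply AEEqFun.ext
    filter_upwards [AEEqFun.ext_iff.1 (congrArg Subtype.val hb), coeFn_smul0 N (f (T b)).1,
      coeFn_smul0 M b.1, hM, hN] with ω h1 h2 h3 h4 h5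
    rw [h3, h4, ← h1]
    change _ = _ • smul0 N (f (T b)).1 ω
    rw [h2, h5, smul_inv_smul₀ (by positivity)]
  refine ⟨T b, Subtype.ext (AEEqFun.ext ?_)⟩
  -- The point `M b = f (T b)` already lies in `G`, so its projection `T b` is at distance zero from
  -- it.
  filter_upwards [(hπ (smul0 M b.1)).2 _ (f (T b)).2] with ω h1
  rw [hfT] at h1 ⊢
  rw [sub_self, norm_zero] at h1
  exact sub_eq_zero.1 (norm_le_zero_iff.1 h1)

/-! ### The unit ball as a bounded closed convex set -/

theorem unitBall_nonempty : (unitBall P d).Nonempty :=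
  ⟨_, (constBall P ⟨0, by simp⟩).2⟩

theorem isASBounded_unitBall : IsASBounded (unitBall P d) := by
  -- The supremum is attained at a constant vector of maximal norm, which also covers `d = 0`, where
  -- it is 0 rather than 1.
  obtain ⟨v, hv, hmax⟩ := (isCompact_closedBall (0 : EuclideanSpace ℝ (Fin d)) 1).exists_isMaxOn
    ⟨0, by simp⟩ continuous_norm.continuousOn
  let e := constBall P ⟨v, hv⟩
  have he : ∀ᵐ ω ∂P, norm0 e.1 ω = ‖v‖ := by
    filter_upwards [coeFn_norm0 e.1, coeFn_constBall (P := P) ⟨v, hv⟩] with ω h1 h2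
    rw [h1, h2]
  refine ⟨norm0 e.1, ?_, IsGreatest.isLUB ⟨⟨e.1, e.2, rfl⟩, ?_⟩⟩
  · rw [← AEEqFun.coeFn_le]
    filter_upwards [he, AEEqFun.coeFn_zero (α := Ω) (μ := P) (β := ℝ)] with ω h1 h2
    rw [h1, h2]
    exact norm_nonneg v
  · rintro _ ⟨x, hx, rfl⟩
    refine toExt_le_toExt_iff.2 ?_
    filter_upwards [he, coeFn_norm0 x, hx] with ω h1 h2 h3
    rw [h1, h2]
    exact hmax h3

theorem isClosed_unitBall : IsClosed[Tc P d] (unitBall P d) := by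
  let _ := Tc P d
  refine isOpen_compl_iff.1 (isOpen_Tc_iff.2 fun x hx => ?_)
  -- A radius must be positive everywhere; where `x` is inside the ball the value 1 is arbitrary.
  have hm : Measurable fun ω => if 1 < ‖x ω‖ then ‖x ω‖ - 1 else 1 :=
    Measurable.ite (measurableSet_lt measurable_const x.measurable.norm)
      (x.measurable.norm.sub_const 1) measurable_const
  have hr := AEEqFun.coeFn_mk (μ := P) _ hm.aestronglyMeasurable
  refine ⟨AEEqFun.mk _ hm.aestronglyMeasurable, ?_, fun y hy hyB => hx (mem_unitBall_iff.2 ?_)⟩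
  · filter_upwards [hr] with ω h
    rw [h]
    split_ifs with h1
    exacts [sub_pos.2 h1, one_pos]
  · rw [mem_randomBall_iff] at hy
    filter_upwards [hr, hy, mem_unitBall_iff.1 hyB] with ω h1 h2 h3
    by_contra! hlt
    rw [h1, if_pos hlt] at h2
    linarith [norm_le_norm_add_norm_sub (y ω) (x ω), norm_sub_rev (x ω) (y ω)]

theorem isL0Convex_unitBall : IsL0Convex (unitBall P d) := by
  intro x hx y hy l hl0 hl1
  rw [mem_unitBall_iff] at hx hy ⊢
  rw [← AEEqFun.coeFn_le] at hl0 hl1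
  filter_upwards [hx, hy, hl0, hl1, AEEqFun.coeFn_zero (α := Ω) (μ := P) (β := ℝ),
    AEEqFun.coeFn_one (α := Ω) (μ := P) (β := ℝ), AEEqFun.coeFn_add (smul0 l x) (smul0 (1 - l) y),
    coeFn_smul0 l x, coeFn_smul0 (1 - l) y, AEEqFun.coeFn_sub (1 : L0 P) l]
    with ω h1 h2 h3 h4 h5 h6 h7 h8 h9 h10
  rw [h5, Pi.zero_apply] at h3
  rw [h6, Pi.one_apply] at h4
  rw [h7, Pi.add_apply, h8, h9, h10, Pi.sub_apply, h6, Pi.one_apply]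
  refine (norm_add_le _ _).trans ?_
  rw [norm_smul, norm_smul, Real.norm_of_nonneg h3, Real.norm_of_nonneg (sub_nonneg.2 h4)]
  nlinarith [norm_nonneg (x ω), norm_nonneg (y ω)]

theorem RandomBrouwerTheorem.randomBrouwerBall (h : RandomBrouwerTheorem P d) :
    RandomBrouwerBall P d := fun f hf hfc =>
  h _ unitBall_nonempty isSigmaStable_unitBall isASBounded_unitBall isClosed_unitBall
    isL0Convex_unitBall f hf hfc

/-! ### Borsuk and Brouwer -/

theorem IsTcRetract.isTcRImage {E F : Set (L0E P d)} (h : IsTcRetract E F) : IsTcRImage E F := by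
  obtain ⟨hEF, r, hE, hF, hr, hrc, hfix⟩ := h
  have hi : IsStableMap (Set.inclusion hEF) ∧ IsTcContinuous (Set.inclusion hEF) :=
    stable_continuous_of_lipschitz hE 1 fun x y => by
      filter_upwards [AEEqFun.coeFn_one (α := Ω) (μ := P) (β := ℝ)] with ω h
      simp [h]
  exact ⟨hE, hF, r, Set.inclusion hEF, hr, hrc, hi.1, hi.2, hfix⟩

theorem RandomBrouwerBall.not_isTcRImage [NeZero P] (hB : RandomBrouwerBall P d) :
    ¬ IsTcRImage (unitSphere P d) (unitBall P d) := by
  rintro ⟨hS, -, h, g, hh, hhc, hg, hgc, hgh⟩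
  let a : unitSphere P d → unitSphere P d := fun x => ⟨-x.1, mem_unitSphere_iff.2 <| by
    filter_upwards [AEEqFun.coeFn_neg x.1, mem_unitSphere_iff.1 x.2] with ω h1 h2
    rw [h1, Pi.neg_apply, norm_neg, h2]⟩
  have ha : IsStableMap a ∧ IsTcContinuous a :=
    stable_continuous_of_lipschitz hS 1 fun x y => by
      filter_upwards [AEEqFun.coeFn_one (α := Ω) (μ := P) (β := ℝ), AEEqFun.coeFn_neg x.1,
        AEEqFun.coeFn_neg y.1] with ω h1 h2 h3
      rw [h1, Pi.one_apply, one_mul, h2, h3, Pi.neg_apply, Pi.neg_apply, neg_sub_neg, norm_sub_rev]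
  obtain ⟨x, hx⟩ := hB (g ∘ a ∘ h) (hg.comp (ha.1.comp hh)) (hgc.comp (ha.2.comp hhc))
  -- Applying `h` to the fixed-point equation and cancelling `h ∘ g` leaves a fixed point of the
  -- antipodal map.
  have hfix : a (h x) = h x := by
    rw [← hgh (a (h x))]
    exact congrArg h hx
  have hfalse : ∀ᵐ ω ∂P, False := by
    filter_upwards [AEEqFun.ext_iff.1 (congrArg Subtype.val hfix), AEEqFun.coeFn_neg (h x).1,
      mem_unitSphere_iff.1 (h x).2] with ω h1 h2 h3
    have h0 : (2 : ℝ) • (h x).1 ω = 0 := by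
      rw [two_smul]
      exact eq_neg_iff_add_eq_zero.1 (h1.symm.trans h2)
    replace h0 := (smul_eq_zero.1 h0).resolve_left two_ne_zero
    rw [h0, norm_zero] at h3
    exact zero_ne_one h3
  -- An almost surely false statement is contradictory because `P` is nonzero.
  obtain ⟨ω, hω⟩ := hfalse.exists
  exact hω

theorem randomBorsuk_iff_randomBrouwerBall [NeZero P] :
    RandomBorsuk P d ↔ RandomBrouwerBall P d :=
  ⟨fun h => by_contra fun hB => h.2 (isTcRetract_of_not_randomBrouwerBall hB), fun h =>
    ⟨h.not_isTcRImage, fun hr => h.not_isTcRImage hr.isTcRImage⟩⟩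

end RandomBrouwer

theorem mainTheorem9 {Ω : Type*} [MeasurableSpace Ω] (P : Measure Ω) [IsProbabilityMeasure P]
    (d : ℕ) :
    (RandomBrouwer.RandomBorsuk P d ↔ RandomBrouwer.RandomBrouwerBall P d) ∧
    (RandomBrouwer.RandomBorsuk P d ↔ RandomBrouwer.RandomBrouwerTheorem P d) ∧
    (¬ RandomBrouwer.RandomBrouwerBall P d →
      RandomBrouwer.IsTcRetract (RandomBrouwer.unitSphere P d) (RandomBrouwer.unitBall P d)) ∧
    (∀ (D : Set (RandomBrouwer.L0E P d)) (hSD : RandomBrouwer.unitSphere P d ⊆ D),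
      D ⊆ RandomBrouwer.unitBall P d → RandomBrouwer.IsSigmaStable D →
      ∀ f : D → RandomBrouwer.unitBall P d,
        RandomBrouwer.IsStableMap f → RandomBrouwer.IsTcContinuous f →
        (∀ x : D, RandomBrouwer.LtOnΩ 0
          (RandomBrouwer.norm0 ((f x : RandomBrouwer.L0E P d) - (x : RandomBrouwer.L0E P d)))) →
        ∃ (l : D → RandomBrouwer.L0 P) (h : D → RandomBrouwer.unitSphere P d),
          (∀ x : D, IsLeast
            (RandomBrouwer.lineSphereParams (x : RandomBrouwer.L0E P d) (f x)) (l x)) ∧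
          (∀ x : D, ∀ᵐ ω ∂P, l x ω =
            (inner ℝ (x.1 ω) (x.1 ω - (f x).1 ω) -
              √(inner ℝ (x.1 ω) (x.1 ω - (f x).1 ω) ^ 2 +
                ‖x.1 ω - (f x).1 ω‖ ^ 2 * (1 - ‖x.1 ω‖ ^ 2))) / ‖(f x).1 ω - x.1 ω‖ ^ 2) ∧
          (∀ x : D, (h x : RandomBrouwer.L0E P d) =
            (x : RandomBrouwer.L0E P d) + RandomBrouwer.smul0 (l x)
              ((f x : RandomBrouwer.L0E P d) - (x : RandomBrouwer.L0E P d))) ∧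
          RandomBrouwer.IsTcRetraction hSD h) := by
  exact ⟨RandomBrouwer.randomBorsuk_iff_randomBrouwerBall,
    RandomBrouwer.randomBorsuk_iff_randomBrouwerBall.trans
      ⟨fun h => h.randomBrouwerTheorem, fun h => h.randomBrouwerBall⟩,
    RandomBrouwer.isTcRetract_of_not_randomBrouwerBall,
    fun _ hSD hDB hD f hf hfc hne =>
      RandomBrouwer.exists_retraction_of_forall_ne hSD hDB hD f hf hfc hne⟩
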